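/- Let $X=\{X_i\}_{i\in\mathbb Z}$ be a stationary process with values in $[0,1]$ that is $\psi^*$-mixing, i.e. $\psi^*(g)=\sup\frac{P(\mathcal A\cap\mathcal B)}{P(\mathcal A)P(\mathcal B)}\to1$ as $g\to\infty$, where the supremum is over all $j$ and all events $\mathcal A\in\sigma(X_i:i\le j)$ and $\mathcal B\in\sigma(X_i:i\ge j+g)$ of positive probability. Logarithms are to base $2$, $[x]_b=2^{-b}\lfloor 2^bx\rfloor$ is the $b$-bit quantization (applied entrywise to vectors), and $\mathcal X_b=\{[x]_b:x\in[0,1]\}$. Let $$\bar d_o(X)=\lim_{k\to\infty}\ \limsup_{b\to\infty}\ \frac{H([X_{k+1}]_b\mid[X_1]_b,\dots,[X_k]_b)}{b}$$ be the upper information dimension of $X$. For $u\in\mathbb R^n$ let $\hat H_k(u)=H(U_{k+1}\mid U_1,\dots,U_k)$ be the conditional empirical entropy, where $(U_1,\dots,U_{k+1})$ is distributed as a uniformly chosen cyclic window of length $k+1$ of $u$. Let $r>1$, $\delta>0$, and let $b_n=\lceil r\log\log n\rceil$, $\lambda_n=(\log n)^{2r}$, and $k_n\to\infty$ with $k_n=o(\log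 n/\log\log n)$. Let $m_n\ge(1+\delta)\,\bar d_o(X)\,n$ for all large $n$, where $m_n$ is of exact order $n$, i.e. there are constants $0<\kappa\le K<\infty$ with $\kappa n\le m_n\le Kn$ for all large $n$ (the lower bound is automatic if $\bar d_o(X)>0$). For each $n$ let $A_n\in\mathbb R^{m_n\times n}$ have i.i.d. $\mathcal N(0,1)$ entries and be independent of the source block $X^n=(X_1,\dots,X_n)$. Let $Y_n=A_nX^n+Z_n$, where $Z_n$ is a random noise vector in $\mathbb R^{m_n}$ (not necessarily independent of $A_n$ and $X$). Assume that there is a deterministic sequence $c_m$ with $c_m=O(m/(\log m)^r)$ as $m\to\infty$ such that $P(\|Z_n\|_2>c_{m_n})\to0$ as $n\to\infty$. Let $\hat X^n$ be any solution of the Lagrangian-MEP problem $$\hat X^n\in\operatorname*{arg\,min}_{u\in\mathcal X_{b_n}^n}\Big(\hat H_{k_n}(u)+\frac{\lambda_n}{n^2}\|A_nu-Y_n\|_2^2\Big).$$ Then $\frac1{\sqrt n}\|X^n-\hat X^n\|_2\to0$ in probability as $n\to\infty$. -/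

import Mathlib

open MeasureTheory ProbabilityTheory Filter Topology Asymptotics

noncomputable section

namespace CS

/-- The `b`-bit quantization `[x]_b` of a real number: keep the integer part and the first `b`
binary digits of the fractional part. -/
def quant (b : ℕ) (x : ℝ) : ℝ := (⌊(2 : ℝ) ^ b * x⌋ : ℝ) / 2 ^ b

/-- The quantized alphabet `{[x]_b : x ∈ [0,1]}`. -/
def quantAlphabet (b : ℕ) : Set ℝ := quant b '' Set.Icc 0 1

/-- The conditional entropy `H(U_{k+1} | U_1, …, U_k)`, in bits, of a finitely supported
distribution `p` of `(U_1, …, U_{k+1})`: the sum of `p(u) log₂ (p(u_1, …, u_k) / p(u))`. -/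
def condEntropyLast {k : ℕ} (p : (Fin (k + 1) → ℝ) → ℝ) : ℝ :=
  ∑' u : Fin (k + 1) → ℝ,
    p u * Real.logb 2 ((∑' s : ℝ, p (Fin.snoc (α := fun _ => ℝ) (Fin.init u) s)) / p u)

/-- The `k`-th order empirical distribution of `x = (x_1, …, x_n)`: the fraction of the `n` cyclic
windows of length `k` of `x` that are equal to `a`. -/
def empDist {n k : ℕ} (x : Fin n → ℝ) (a : Fin k → ℝ) : ℝ :=
  (Nat.card {i : Fin n //
    ∀ j : Fin k, x ⟨((i : ℕ) + j) % n, Nat.mod_lt _ (Nat.zero_lt_of_lt i.isLt)⟩ = a j} : ℝ) / n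

/-- The conditional empirical entropy `Ĥ_k(x)` of order `k` of a sequence `x`. -/
def condEmpEntropy {n : ℕ} (k : ℕ) (x : Fin n → ℝ) : ℝ :=
  condEntropyLast (k := k) (empDist x)

variable {Ω : Type*} [MeasurableSpace Ω]

/-- The distribution of `([X_1]_b, …, [X_k]_b)`, as a function of the `k`-tuple of values. -/
def quantDist (μ : Measure Ω) (X : ℤ → Ω → ℝ) (b k : ℕ) (a : Fin k → ℝ) : ℝ :=
  μ.real {ω | ∀ j : Fin k, quant b (X ((j : ℕ) + 1) ω) = a j}

/-- The `k`-th order upper information dimension: the upper limit, as `b → ∞`, of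
`H([X_{k+1}]_b | [X_1]_b, …, [X_k]_b) / b`. -/
def upperInfoDimOrder (μ : Measure Ω) (X : ℤ → Ω → ℝ) (k : ℕ) : ℝ :=
  limsup (fun b : ℕ => condEntropyLast (quantDist μ X b (k + 1)) / (b : ℝ)) atTop

/-- The upper information dimension of the process: the limit of the `k`-th order upper
information dimensions. -/
def upperInfoDim (μ : Measure Ω) (X : ℤ → Ω → ℝ) : ℝ :=
  limUnder atTop (fun k : ℕ => upperInfoDimOrder μ X k)

/-- The law of the process is invariant under the time shift. -/
def IsStationary (μ : Measure Ω) (X : ℤ → Ω → ℝ) : Prop :=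
  μ.map (fun ω (i : ℤ) => X (i + 1) ω) = μ.map (fun ω (i : ℤ) => X i ω)

/-- The sigma-algebra generated by the variables `X_i`, `i ∈ s`. -/
abbrev sigmaOf (X : ℤ → Ω → ℝ) (s : Set ℤ) : MeasurableSpace Ω :=
  ⨆ i ∈ s, MeasurableSpace.comap (X i) inferInstance

/-- The mixing coefficient `ψ*(g)`: the supremum of `P(A ∩ B) / (P(A) P(B))` over events `A` of
positive probability in the sigma-algebra of `(X_i)_{i ≤ j}` and events `B` of positive
probability in that of `(X_i)_{i ≥ j + g}`, over all times `j`; it may be infinite. -/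
def psiStar (μ : Measure Ω) (X : ℤ → Ω → ℝ) (g : ℕ) : ENNReal :=
  sSup {q | ∃ (j : ℤ) (A B : Set Ω),
    MeasurableSet[sigmaOf X (Set.Iic j)] A ∧ MeasurableSet[sigmaOf X (Set.Ici (j + g))] B ∧
    0 < μ A ∧ 0 < μ B ∧ q = μ (A ∩ B) / (μ A * μ B)}

/-- The process is `ψ*`-mixing: `ψ*(g) → 1` as `g → ∞`. -/
def IsPsiStarMixing (μ : Measure Ω) (X : ℤ → Ω → ℝ) : Prop :=
  Tendsto (psiStar μ X) atTop (𝓝 1)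

/-- The Lagrangian-MEP cost `Ĥ_k(u) + (lam / n²) ‖A u - y‖₂²`. -/
def mepCost {m n : ℕ} (k : ℕ) (lam : ℝ) (A : Matrix (Fin m) (Fin n) ℝ) (y : Fin m → ℝ)
    (u : Fin n → ℝ) : ℝ :=
  condEmpEntropy k u + lam / (n : ℝ) ^ 2 * ‖WithLp.toLp 2 (A.mulVec u - y)‖ ^ 2

/-- `x` is a solution of the Lagrangian-MEP problem: it minimizes the cost over all vectors with
entries in the `b`-bit quantized alphabet. -/
def IsMEPSolution {m n : ℕ} (k b : ℕ) (lam : ℝ) (A : Matrix (Fin m) (Fin n) ℝ) (y : Fin m → ℝ)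
    (x : Fin n → ℝ) : Prop :=
  (∀ i, x i ∈ quantAlphabet b) ∧
    ∀ u : Fin n → ℝ, (∀ i, u i ∈ quantAlphabet b) → mepCost k lam A y x ≤ mepCost k lam A y u

/-- The source block `(X_1, …, X_n)`. -/
def block (X : ℤ → Ω → ℝ) (n : ℕ) (ω : Ω) : Fin n → ℝ := fun i => X ((i : ℕ) + 1) ω

end CS

end

/-! Write $b=b_n$, $k=k_n$, $m=m_n$, $B=(\log n)^r$, so that $\lambda_n=B^2$ and $B\le 2^b\le 2B$,
and compare the minimizer with the quantized source $q=[X^n]_b$. Choose $\bar d_o(X)<d_1<d_2<d_3$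
with $m\ge d_3n$ eventually. Four bad events have vanishing probability.

(1) $\hat H_k(q)>d_1b$. By Gibbs' inequality, $\hat H_k(q)$ is at most the average code length of
$q$ under any positive kernel of fixed order $k_0\le k$. Taking the true conditional law mixed with
the uniform law makes this an average of a window function bounded by $b+2$ with mean at most
$1+H([X_{k_0+1}]_b\mid[X_1]_b,\dots,[X_{k_0}]_b)$. The function changes with $n$, so the law of
large numbers must be uniform in the function; `eventually_measure_sum_window_ge_le` gets this from
$\psi^*$-mixing by a second-moment bound. The result is `tendsto_measure_condEmpEntropy_gt`.

(2) $\|A(X^n-q)\|^2\ge K\sqrt b\,n^2/B^2$. The mean is at most $mn4^{-b}\le Kn^2/B^2$, so Markov's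
inequality gives probability at most $1/\sqrt b$.

(3) The noise exceeds its bound, which is at most $Cn/B$.

(4) Some $u$ over the quantized alphabet with $\hat H_k(u)\le d_2b$ is at distance at least
$\varepsilon\sqrt n$ from $X^n$ although $\|A(X^n-u)\|^2\le T$, where $T$ is of order $bn^2/B^2$. A
Markov-type counting argument (`card_condEmpEntropy_le`) leaves at most $2^{n+d_2bn}$ candidates,
and the chi-squared Chernoff bound charges each at most $2^{-\theta bm}$, for any fixed $\theta<1$.
With $d_2<\theta d_3$ the union bound is at most $2^{-n}$.

Outside these events, comparing costs at $\hat X^n$ and $q$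
(`IsMEPSolution.condEmpEntropy_le_and_norm_le`) gives $\hat H_k(\hat X^n)\le d_2b$ and $\|A(X^n-\hat
X^n)\|^2\le T$. Since (4) fails, $\hat X^n$ is within $\varepsilon\sqrt n$ of $X^n$. Noise enters
only through (3), so no independence from $A$ or $X$ is required of it. -/

namespace CS

/-! ### Conditional entropy of finitely supported weights and Gibbs' inequality. -/

/-- The `k`-tuples with entries in a finite set `S` of reals. -/
abbrev tuples (S : Finset ℝ) (k : ℕ) : Finset (Fin k → ℝ) := Fintype.piFinset fun _ => S

/-- Append an entry to a tuple of reals. -/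
abbrev snocR {k : ℕ} (c : Fin k → ℝ) (s : ℝ) : Fin (k + 1) → ℝ :=
  Fin.snoc (α := fun _ => ℝ) c s

/-- The conditional distribution of the last entry given the others, under the weights `p`. -/
noncomputable def kernelOf (S : Finset ℝ) {k : ℕ} (p : (Fin (k + 1) → ℝ) → ℝ)
    (u : Fin (k + 1) → ℝ) : ℝ :=
  p u / ∑ s ∈ S, p (snocR (Fin.init u) s)

lemma snocR_mem_tuples {S : Finset ℝ} {k : ℕ} {c : Fin k → ℝ} {s : ℝ} :
    snocR c s ∈ tuples S (k + 1) ↔ c ∈ tuples S k ∧ s ∈ S := by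
  simp only [Fintype.mem_piFinset, Fin.forall_fin_succ', snocR, Fin.snoc_castSucc, Fin.snoc_last]

lemma sum_tuples_succ {M : Type*} [AddCommMonoid M] (S : Finset ℝ) {k : ℕ}
    (F : (Fin (k + 1) → ℝ) → M) :
    ∑ u ∈ tuples S (k + 1), F u = ∑ c ∈ tuples S k, ∑ s ∈ S, F (snocR c s) := by
  rw [← Finset.sum_product']
  refine (Finset.sum_bij' (fun x _ => snocR x.1 x.2) (fun u _ => (Fin.init u, u (Fin.last k)))
    ?_ ?_ ?_ ?_ ?_).symm
  · rintro ⟨c, s⟩ h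
    exact snocR_mem_tuples.2 (Finset.mem_product.1 h)
  · intro u hu
    refine Finset.mem_product.2 (snocR_mem_tuples.1 ?_)
    simpa [snocR] using hu
  · rintro ⟨c, s⟩ _
    simp [snocR]
  · intro u _
    simp [snocR]
  · rintro ⟨c, s⟩ _
    rfl

lemma kernelOf_snocR (S : Finset ℝ) {k : ℕ} (p : (Fin (k + 1) → ℝ) → ℝ) (c : Fin k → ℝ)
    (s : ℝ) : kernelOf S p (snocR c s) = p (snocR c s) / ∑ t ∈ S, p (snocR c t) := by
  simp [kernelOf, snocR]

lemma sum_kernelOf_le_one (S : Finset ℝ) {k : ℕ} (p : (Fin (k + 1) → ℝ) → ℝ) (c : Fin k → ℝ) :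
    ∑ s ∈ S, kernelOf S p (snocR c s) ≤ 1 := by
  simp only [kernelOf_snocR]
  rw [← Finset.sum_div]
  exact div_self_le_one _

lemma kernelOf_nonneg (S : Finset ℝ) {k : ℕ} {p : (Fin (k + 1) → ℝ) → ℝ} (hp : ∀ u, 0 ≤ p u)
    (u : Fin (k + 1) → ℝ) : 0 ≤ kernelOf S p u :=
  div_nonneg (hp u) (Finset.sum_nonneg fun _ _ => hp _)

lemma le_sum_snocR {S : Finset ℝ} {k : ℕ} {p : (Fin (k + 1) → ℝ) → ℝ} (hp : ∀ u, 0 ≤ p u)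
    {u : Fin (k + 1) → ℝ} (hu : u ∈ tuples S (k + 1)) :
    p u ≤ ∑ s ∈ S, p (snocR (Fin.init u) s) := by
  have h := Finset.single_le_sum (f := fun s => p (snocR (Fin.init u) s)) (fun s _ => hp _)
    (Fintype.mem_piFinset.1 hu (Fin.last k))
  simpa [snocR] using h

lemma kernelOf_pos {S : Finset ℝ} {k : ℕ} {p : (Fin (k + 1) → ℝ) → ℝ} (hp : ∀ u, 0 ≤ p u)
    {u : Fin (k + 1) → ℝ} (hu : u ∈ tuples S (k + 1)) (hpu : 0 < p u) : 0 < kernelOf S p u :=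
  div_pos hpu (hpu.trans_le (le_sum_snocR hp hu))

lemma kernelOf_le_one {S : Finset ℝ} {k : ℕ} {p : (Fin (k + 1) → ℝ) → ℝ} (hp : ∀ u, 0 ≤ p u)
    {u : Fin (k + 1) → ℝ} (hu : u ∈ tuples S (k + 1)) : kernelOf S p u ≤ 1 :=
  div_le_one_of_le₀ (le_sum_snocR hp hu) (Finset.sum_nonneg fun _ _ => hp _)

lemma condEntropyLast_eq_sum {S : Finset ℝ} {k : ℕ} {p : (Fin (k + 1) → ℝ) → ℝ}
    (hS : ∀ u, u ∉ tuples S (k + 1) → p u = 0) :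
    condEntropyLast p = ∑ u ∈ tuples S (k + 1), p u * -Real.logb 2 (kernelOf S p u) := by
  unfold condEntropyLast
  rw [tsum_eq_sum (s := tuples S (k + 1)) (fun u hu => by rw [hS u hu, zero_mul])]
  refine Finset.sum_congr rfl fun u _ => ?_
  rw [tsum_eq_sum (s := S) (fun s hs => hS _ fun h => hs (snocR_mem_tuples.1 h).2), kernelOf,
    ← Real.logb_inv, inv_div]

lemma condEntropyLast_nonneg {S : Finset ℝ} {k : ℕ} {p : (Fin (k + 1) → ℝ) → ℝ}
    (hp : ∀ u, 0 ≤ p u) (hS : ∀ u, u ∉ tuples S (k + 1) → p u = 0) : 0 ≤ condEntropyLast p := by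
  rw [condEntropyLast_eq_sum hS]
  refine Finset.sum_nonneg fun u hu => mul_nonneg (hp u) (neg_nonneg.2 ?_)
  exact Real.logb_nonpos one_lt_two (kernelOf_nonneg S hp u) (kernelOf_le_one hp hu)

/-- Gibbs' inequality for conditional entropies: cross-entropy dominates entropy. -/
lemma condEntropyLast_le_sum {S : Finset ℝ} {k : ℕ} {p r : (Fin (k + 1) → ℝ) → ℝ}
    (hp : ∀ u, 0 ≤ p u) (hS : ∀ u, u ∉ tuples S (k + 1) → p u = 0) (hr : ∀ u, 0 ≤ r u)
    (hr1 : ∀ c, ∑ s ∈ S, r (snocR c s) ≤ 1) (hpr : ∀ u, 0 < p u → 0 < r u) :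
    condEntropyLast p ≤ ∑ u ∈ tuples S (k + 1), p u * -Real.logb 2 (r u) := by
  rw [condEntropyLast_eq_sum hS]
  set q : (Fin (k + 1) → ℝ) → ℝ := fun u => ∑ s ∈ S, p (snocR (Fin.init u) s) with hq
  have key : ∀ u ∈ tuples S (k + 1), p u * -Real.logb 2 (kernelOf S p u)
      ≤ p u * -Real.logb 2 (r u) + (q u * r u - p u) / Real.log 2 := by
    intro u hu
    have hl : 0 < Real.log 2 := Real.log_pos one_lt_two
    have hq0 : 0 ≤ q u := Finset.sum_nonneg fun _ _ => hp _
    rcases (hp u).eq_or_lt with h0 | h0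
    · rw [← h0]
      have := div_nonneg (mul_nonneg hq0 (hr u)) hl.le
      simpa using this
    · have hqu : 0 < q u := h0.trans_le (le_sum_snocR hp hu)
      have hru := hpr u h0
      have hk : kernelOf S p u = p u / q u := rfl
      -- With `q` the marginal of the context, this is $\log x\le x-1$ at $x=qr/p$. The remainders
      -- $qr-p$ have a nonpositive total because `r` is substochastic given the context.
      have hlog := Real.log_le_sub_one_of_pos (x := q u * r u / p u) (by positivity)
      rw [Real.log_div (by positivity) h0.ne', Real.log_mul hqu.ne' hru.ne'] at hlog
      rw [hk, Real.logb, Real.logb, Real.log_div h0.ne' hqu.ne', ← sub_nonneg]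
      have : p u * -(Real.log (r u) / Real.log 2) + (q u * r u - p u) / Real.log 2
          - p u * -((Real.log (p u) - Real.log (q u)) / Real.log 2)
          = p u * ((q u * r u / p u - 1) - (Real.log (q u) + Real.log (r u) - Real.log (p u)))
            / Real.log 2 := by
        field_simp
        ring
      rw [this]
      exact div_nonneg (mul_nonneg h0.le (sub_nonneg.2 hlog)) hl.le
  refine (Finset.sum_le_sum key).trans ?_
  rw [Finset.sum_add_distrib, ← Finset.sum_div, Finset.sum_sub_distrib]
  have h1 : ∑ u ∈ tuples S (k + 1), q u * r u ≤ ∑ u ∈ tuples S (k + 1), p u := by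
    rw [sum_tuples_succ, sum_tuples_succ]
    refine Finset.sum_le_sum fun c _ => ?_
    simp only [hq, snocR, Fin.init_snoc]
    rw [← Finset.mul_sum]
    exact mul_le_of_le_one_right (Finset.sum_nonneg fun _ _ => hp _) (hr1 c)
  have h2 : (∑ u ∈ tuples S (k + 1), q u * r u - ∑ u ∈ tuples S (k + 1), p u) / Real.log 2 ≤ 0 :=
    div_nonpos_of_nonpos_of_nonneg (sub_nonpos.2 h1) (Real.log_pos one_lt_two).le
  linarith

lemma snocR_comp_natAdd {l k : ℕ} (c : Fin (l + k) → ℝ) (s : ℝ) :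
    (fun j : Fin (k + 1) => snocR c s (Fin.natAdd l j)) = snocR (fun j => c (Fin.natAdd l j)) s :=
  Fin.snoc_comp_natAdd c s

/-! ### Cyclic windows and empirical distributions. -/

/-- The cyclic window of length `k` of `x` that starts at position `i`. -/
def cycWindow {n : ℕ} (hn : 0 < n) (x : Fin n → ℝ) (k i : ℕ) : Fin k → ℝ :=
  fun j => x ⟨(i + j) % n, Nat.mod_lt _ hn⟩

lemma cycWindow_mem_tuples {n : ℕ} (hn : 0 < n) {x : Fin n → ℝ} {S : Finset ℝ}
    (hx : ∀ i, x i ∈ S) (k i : ℕ) : cycWindow hn x k i ∈ tuples S k :=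
  Fintype.mem_piFinset.2 fun _ => hx _

lemma cycWindow_mod {n : ℕ} (hn : 0 < n) (x : Fin n → ℝ) (k i : ℕ) :
    cycWindow hn x k (i % n) = cycWindow hn x k i := by
  funext j
  simp [cycWindow]

lemma empDist_eq {n : ℕ} (hn : 0 < n) (x : Fin n → ℝ) {k : ℕ} (a : Fin k → ℝ) :
    empDist x a = (∑ i ∈ Finset.range n, if cycWindow hn x k i = a then (1 : ℝ) else 0) / n := by
  unfold empDist
  congr 1
  rw [Finset.sum_range (fun i => if cycWindow hn x k i = a then (1 : ℝ) else 0),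
    Finset.sum_boole, Nat.card_eq_fintype_card, Fintype.card_subtype]
  simp only [funext_iff, cycWindow]

lemma empDist_nonneg {n : ℕ} (x : Fin n → ℝ) {k : ℕ} (a : Fin k → ℝ) : 0 ≤ empDist x a :=
  div_nonneg (Nat.cast_nonneg _) (Nat.cast_nonneg _)

lemma empDist_eq_zero {n : ℕ} (hn : 0 < n) {x : Fin n → ℝ} {S : Finset ℝ} (hx : ∀ i, x i ∈ S)
    {k : ℕ} {a : Fin k → ℝ} (ha : a ∉ tuples S k) : empDist x a = 0 := by
  rw [empDist_eq hn, Finset.sum_eq_zero, zero_div]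
  intro i _
  refine if_neg fun h => ha ?_
  rw [← h]
  exact cycWindow_mem_tuples hn hx k i

lemma sum_empDist_mul {n : ℕ} (hn : 0 < n) {x : Fin n → ℝ} {S : Finset ℝ} (hx : ∀ i, x i ∈ S)
    {k : ℕ} (g : (Fin k → ℝ) → ℝ) :
    ∑ a ∈ tuples S k, empDist x a * g a
      = (∑ i ∈ Finset.range n, g (cycWindow hn x k i)) / n := by
  simp only [empDist_eq hn, div_mul_eq_mul_div]
  rw [← Finset.sum_div]
  congr 1
  simp only [Finset.sum_mul]
  rw [Finset.sum_comm]
  refine Finset.sum_congr rfl fun i _ => ?_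
  rw [Finset.sum_eq_single_of_mem _ (cycWindow_mem_tuples hn hx k i)]
  · simp
  · intro a _ ha
    simp [ha.symm]

lemma empDist_cycWindow_pos {n : ℕ} (hn : 0 < n) (x : Fin n → ℝ) (k : ℕ) {i : ℕ} (hi : i < n) :
    0 < empDist x (cycWindow hn x k i) := by
  rw [empDist_eq hn]
  refine div_pos ?_ (by exact_mod_cast hn)
  refine Finset.sum_pos' (fun j _ => by split_ifs <;> norm_num) ⟨i, Finset.mem_range.2 hi, by simp⟩

lemma exists_cycWindow_of_empDist_pos {n : ℕ} (hn : 0 < n) {x : Fin n → ℝ} {k : ℕ}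
    {a : Fin k → ℝ} (ha : 0 < empDist x a) : ∃ i < n, cycWindow hn x k i = a := by
  by_contra! h
  rw [empDist_eq hn, Finset.sum_eq_zero, zero_div] at ha
  · exact ha.false
  · intro i hi
    exact if_neg (h i (Finset.mem_range.1 hi))

lemma condEmpEntropy_nonneg {n : ℕ} (hn : 0 < n) (k : ℕ) (x : Fin n → ℝ) :
    0 ≤ condEmpEntropy k x :=
  condEntropyLast_nonneg (S := Finset.univ.image x) (fun _ => empDist_nonneg x _)
    fun _ hu => empDist_eq_zero hn (fun i => Finset.mem_image_of_mem x (Finset.mem_univ i)) hu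

lemma sum_range_add_mod {M : Type*} [AddCommGroup M] (f : ℕ → M) {n : ℕ}
    (hf : ∀ i, f (i % n) = f i) (l : ℕ) :
    ∑ i ∈ Finset.range n, f (i + l) = ∑ i ∈ Finset.range n, f i := by
  induction l with
  | zero => rfl
  | succ l ih =>
    rw [← ih]
    have h := Finset.sum_range_succ (fun i => f (i + l)) n
    rw [Finset.sum_range_succ' (fun i => f (i + l)) n] at h
    have h2 : f (n + l) = f (0 + l) := by rw [← hf (n + l), ← hf (0 + l)]; simp
    rw [h2] at h
    have h3 := add_right_cancel h
    rw [← h3]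
    exact Finset.sum_congr rfl fun i _ => by congr 1; ring

/-- Gibbs' inequality with a kernel that ignores the first `l` symbols of the context, which also
accounts for the drop in order. Ignoring them moves each window by `l`, and sums over cyclic windows
do not see such a shift. -/
lemma condEmpEntropy_le_sum {n : ℕ} (hn : 0 < n) {x : Fin n → ℝ} {S : Finset ℝ}
    (hx : ∀ i, x i ∈ S) (l : ℕ) {k : ℕ} {r : (Fin (k + 1) → ℝ) → ℝ} (hr : ∀ u, 0 ≤ r u)
    (hr1 : ∀ c, ∑ s ∈ S, r (snocR c s) ≤ 1) (hpos : ∀ u ∈ tuples S (k + 1), 0 < r u) :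
    condEmpEntropy (l + k) x
      ≤ (∑ i ∈ Finset.range n, -Real.logb 2 (r (cycWindow hn x (k + 1) i))) / n := by
  have h := condEntropyLast_le_sum (S := S) (k := l + k) (p := empDist x)
    (r := fun u => r fun j : Fin (k + 1) => u (Fin.natAdd l j)) (fun _ => empDist_nonneg x _)
    (fun _ hu => empDist_eq_zero hn hx hu) (fun _ => hr _)
    (fun c => by simpa only [snocR_comp_natAdd] using hr1 fun j => c (Fin.natAdd l j))
    (fun u hu => by
      obtain ⟨i, _, rfl⟩ := exists_cycWindow_of_empDist_pos hn hu
      exact hpos _ (Fintype.mem_piFinset.2 fun _ => hx _))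
  refine h.trans_eq ?_
  rw [sum_empDist_mul hn hx fun u : Fin (l + k + 1) → ℝ =>
    -Real.logb 2 (r fun j : Fin (k + 1) => u (Fin.natAdd l j))]
  congr 1
  rw [← sum_range_add_mod (fun i => -Real.logb 2 (r (cycWindow hn x (k + 1) i))) (n := n)
    (fun i => by rw [cycWindow_mod]) l]
  refine Finset.sum_congr rfl fun i _ => ?_
  congr 3
  funext j
  simp [cycWindow, add_assoc]

end CS

/-! ### Counting sequences of small conditional empirical entropy. -/

namespace CS

/-- The window of length `k` of `u` that starts at position `i`, padded with zeros. -/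
def padWindow {N : ℕ} (u : Fin N → ℝ) (k i : ℕ) : Fin k → ℝ :=
  fun j => if h : i + j < N then u ⟨i + j, h⟩ else 0

lemma padWindow_snocR_of_lt {N k i : ℕ} (c : Fin N → ℝ) (s : ℝ) (h : i + k < N) :
    padWindow (snocR c s) (k + 1) i = padWindow c (k + 1) i := by
  funext j
  have hj := j.isLt
  have h1 : i + (j : ℕ) < N := by omega
  have h2 : i + (j : ℕ) < N + 1 := by omega
  simp only [padWindow, h1, h2, dif_pos, snocR, Fin.snoc]
  rfl

lemma padWindow_snocR_last {k n : ℕ} (c : Fin (k + n) → ℝ) (s : ℝ) :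
    padWindow (snocR c s) (k + 1) n = snocR (padWindow c k n) s := by
  funext j
  refine Fin.lastCases ?_ (fun j => ?_) j
  · simp [padWindow, snocR, Fin.snoc, add_comm n k]
  · have hj := j.isLt
    have h1 : n + (j : ℕ) < k + n := by omega
    have h2 : n + (j : ℕ) < k + n + 1 := by omega
    simp [padWindow, snocR, Fin.snoc, h1, h2]

lemma cycWindow_eq_padWindow {n : ℕ} (hn : 0 < n) (x : Fin n → ℝ) {k i : ℕ} (h : i + k ≤ n) :
    cycWindow hn x k i = padWindow x k i := by
  funext j
  have hj := j.isLt
  have h1 : i + (j : ℕ) < n := by omega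
  simp [cycWindow, padWindow, h1, Nat.mod_eq_of_lt]

/-- Kraft's inequality for the probabilities assigned by a Markov kernel of order `k`. -/
lemma sum_prod_kernel_le {S : Finset ℝ} {k : ℕ} {r : (Fin (k + 1) → ℝ) → ℝ} (hr : ∀ u, 0 ≤ r u)
    (hr1 : ∀ c, ∑ s ∈ S, r (snocR c s) ≤ 1) (n : ℕ) :
    ∑ u ∈ tuples S (k + n), ∏ i ∈ Finset.range n, r (padWindow u (k + 1) i) ≤ (S.card : ℝ) ^ k := by
  induction n with
  | zero => simp
  | succ n ih =>
    refine le_trans ?_ ih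
    change ∑ u ∈ tuples S (k + n + 1), _ ≤ _
    rw [sum_tuples_succ]
    refine Finset.sum_le_sum fun c _ => ?_
    have : ∀ s ∈ S, ∏ i ∈ Finset.range (n + 1), r (padWindow (snocR c s) (k + 1) i)
        = (∏ i ∈ Finset.range n, r (padWindow c (k + 1) i)) * r (snocR (padWindow c k n) s) := by
      intro s _
      rw [Finset.prod_range_succ, padWindow_snocR_last]
      congr 1
      refine Finset.prod_congr rfl fun i hi => ?_
      rw [padWindow_snocR_of_lt]
      have := Finset.mem_range.1 hi
      omega
    -- Summing out the last symbol costs a factor at most one; only the first `k` symbols stay free,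
    -- whence $|S|^k$.
    rw [Finset.sum_congr rfl this, ← Finset.mul_sum]
    exact mul_le_of_le_one_right (Finset.prod_nonneg fun _ _ => hr _) (hr1 _)

/-- $n\hat H_k(x)$ is the code length of $x$ under its own empirical kernel, so the kernel assigns
$x$ the probability $2^{-n\hat H_k(x)}$. -/
lemma two_rpow_neg_condEmpEntropy {n : ℕ} (hn : 0 < n) {x : Fin n → ℝ} {S : Finset ℝ}
    (hx : ∀ i, x i ∈ S) (k : ℕ) :
    (2 : ℝ) ^ (-(n * condEmpEntropy k x))
      = ∏ i ∈ Finset.range n, kernelOf S (empDist x) (cycWindow hn x (k + 1) i) := by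
  have hn' : (n : ℝ) ≠ 0 := by exact_mod_cast hn.ne'
  rw [condEmpEntropy, condEntropyLast_eq_sum (S := S) (fun u hu => empDist_eq_zero hn hx hu),
    sum_empDist_mul hn hx (k := k + 1) (fun u => -Real.logb 2 (kernelOf S (empDist x) u)),
    mul_div_cancel₀ _ hn', Finset.sum_neg_distrib, neg_neg,
    Real.rpow_sum_of_pos two_pos]
  refine Finset.prod_congr rfl fun i hi => ?_
  exact Real.rpow_logb two_pos one_lt_two.ne' (kernelOf_pos (empDist_nonneg x)
    (cycWindow_mem_tuples hn hx _ i) (empDist_cycWindow_pos hn x _ (Finset.mem_range.1 hi)))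

/-- An empirical distribution is a vector of counts between $0$ and $n$. This bounds the number of
kernels over which the counting argument sums. -/
lemma exists_empDist_eq {n : ℕ} (hn : 0 < n) {x : Fin n → ℝ} {S : Finset ℝ}
    (hx : ∀ i, x i ∈ S) (k : ℕ) : ∃ T : tuples S k → Fin (n + 1),
      (empDist x : (Fin k → ℝ) → ℝ)
        = fun a => if h : a ∈ tuples S k then ((T ⟨a, h⟩ : ℕ) : ℝ) / n else 0 := by
  refine ⟨fun a => ⟨Nat.card {i : Fin n //
    ∀ j : Fin k, x ⟨((i : ℕ) + j) % n, Nat.mod_lt _ (Nat.zero_lt_of_lt i.isLt)⟩ = a.1 j}, ?_⟩, ?_⟩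
  · refine Nat.lt_succ_of_le ?_
    have := Nat.card_le_card_of_injective (Subtype.val : {i : Fin n //
      ∀ j : Fin k, x ⟨((i : ℕ) + j) % n, Nat.mod_lt _ (Nat.zero_lt_of_lt i.isLt)⟩ = a.1 j} → Fin n)
      Subtype.val_injective
    simpa using this
  · funext a
    split_ifs with h
    · rfl
    · exact empDist_eq_zero hn hx h

/-- The number of sequences over `S` of conditional empirical entropy at most `H`. -/
lemma card_condEmpEntropy_le {n : ℕ} (hn : 0 < n) {k : ℕ} (hk : k ≤ n) (S : Finset ℝ) (H : ℝ) :
    (((tuples S n).filter fun u => condEmpEntropy k u ≤ H).card : ℝ)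
      ≤ ((n : ℝ) + 1) ^ (S.card ^ (k + 1)) * (S.card : ℝ) ^ k * (2 : ℝ) ^ (n * H) := by
  classical
  set Q : (tuples S (k + 1) → Fin (n + 1)) → (Fin (k + 1) → ℝ) → ℝ := fun T a =>
    if h : a ∈ tuples S (k + 1) then ((T ⟨a, h⟩ : ℕ) : ℝ) / n else 0 with hQ
  have hQ0 : ∀ T a, 0 ≤ Q T a := by
    intro T a
    simp only [hQ]
    split_ifs <;> positivity
  -- All count vectors `T` are admitted, realizable or not. A sequence of entropy at most `H` gets
  -- mass at least $2^{-nH}$ from its own `T`, while Kraft's inequality bounds the total mass for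
  -- each `T`.
  have key : ∀ u ∈ (tuples S n).filter fun u => condEmpEntropy k u ≤ H,
      (2 : ℝ) ^ (-(n * H)) ≤ ∑ T, ∏ i ∈ Finset.range (n - k),
        kernelOf S (Q T) (padWindow u (k + 1) i) := by
    intro u hu
    obtain ⟨hu1, hu2⟩ := Finset.mem_filter.1 hu
    have hx : ∀ i, u i ∈ S := Fintype.mem_piFinset.1 hu1
    obtain ⟨T, hT⟩ := exists_empDist_eq hn hx (k + 1)
    have h1 : (2 : ℝ) ^ (-(n * H)) ≤ 2 ^ (-(n * condEmpEntropy k u)) := by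
      refine Real.rpow_le_rpow_of_exponent_le one_le_two ?_
      have := mul_le_mul_of_nonneg_left hu2 (Nat.cast_nonneg (α := ℝ) n)
      linarith
    refine h1.trans ?_
    rw [two_rpow_neg_condEmpEntropy hn hx]
    -- The last `k` windows wrap around and do not fit the Markov factorization; their factors are
    -- at most one and are dropped.
    have h2 : ∏ i ∈ Finset.range n, kernelOf S (empDist u) (cycWindow hn u (k + 1) i)
        ≤ ∏ i ∈ Finset.range (n - k), kernelOf S (empDist u) (cycWindow hn u (k + 1) i) := by
      rw [← Finset.prod_range_mul_prod_Ico _ (Nat.sub_le n k)]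
      refine mul_le_of_le_one_right
        (Finset.prod_nonneg fun _ _ => kernelOf_nonneg S (empDist_nonneg u) _) ?_
      exact Finset.prod_le_one (fun _ _ => kernelOf_nonneg S (empDist_nonneg u) _)
        fun i _ => kernelOf_le_one (empDist_nonneg u) (cycWindow_mem_tuples hn hx _ i)
    refine h2.trans ?_
    have h3 : ∏ i ∈ Finset.range (n - k), kernelOf S (empDist u) (cycWindow hn u (k + 1) i)
        = ∏ i ∈ Finset.range (n - k), kernelOf S (Q T) (padWindow u (k + 1) i) := by
      refine Finset.prod_congr rfl fun i hi => ?_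
      have := Finset.mem_range.1 hi
      rw [hT, cycWindow_eq_padWindow hn u (by omega)]
    rw [h3]
    exact Finset.single_le_sum (f := fun T => ∏ i ∈ Finset.range (n - k),
        kernelOf S (Q T) (padWindow u (k + 1) i))
      (fun T _ => Finset.prod_nonneg fun _ _ => kernelOf_nonneg S (hQ0 T) _) (Finset.mem_univ T)
  have hsum : ∑ u ∈ tuples S n, ∑ T, ∏ i ∈ Finset.range (n - k),
      kernelOf S (Q T) (padWindow u (k + 1) i)
      ≤ ((n : ℝ) + 1) ^ (S.card ^ (k + 1)) * (S.card : ℝ) ^ k := by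
    rw [Finset.sum_comm]
    refine (Finset.sum_le_card_nsmul _ _ ((S.card : ℝ) ^ k) fun T _ => ?_).trans_eq ?_
    · have h := sum_prod_kernel_le (S := S) (kernelOf_nonneg S (hQ0 T))
        (sum_kernelOf_le_one S (Q T)) (n - k)
      rwa [Nat.add_sub_cancel' hk] at h
    · simp
  have hcard := Finset.card_nsmul_le_sum _ _ _ key
  have hsub := hcard.trans ((Finset.sum_le_sum_of_subset_of_nonneg (Finset.filter_subset _ _)
    fun u _ _ => Finset.sum_nonneg fun T _ =>
      Finset.prod_nonneg fun _ _ => kernelOf_nonneg S (hQ0 T) _).trans hsum)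
  rw [nsmul_eq_mul, Real.rpow_neg two_pos.le, ← div_eq_mul_inv, div_le_iff₀ (by positivity)] at hsub
  exact hsub

end CS

/-! ### $\psi^*$-mixing, stationarity and a uniform weak law of large numbers. -/

namespace CS

variable {Ω : Type*} [MeasurableSpace Ω]

/-- The window `(X_{i+1}, …, X_{i+k})` of the process. -/
def window (X : ℤ → Ω → ℝ) (k i : ℕ) (ω : Ω) : Fin k → ℝ :=
  fun j => X (((i + j : ℕ) : ℤ) + 1) ω

section mixing

variable {μ : Measure Ω} {X : ℤ → Ω → ℝ}

lemma sigmaOf_le (hX : ∀ i, Measurable (X i)) (s : Set ℤ) :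
    sigmaOf X s ≤ (inferInstance : MeasurableSpace Ω) :=
  iSup₂_le fun i _ => (hX i).comap_le

lemma measurable_sigmaOf {Ω : Type*} {X : ℤ → Ω → ℝ} {s : Set ℤ} {i : ℤ} (hi : i ∈ s) :
    Measurable[sigmaOf X s] (X i) :=
  Measurable.mono (comap_measurable (X i))
    (le_iSup₂ (f := fun i (_ : i ∈ s) => MeasurableSpace.comap (X i) inferInstance) i hi) le_rfl

lemma measurable_window_sigmaOf {Ω : Type*} {X : ℤ → Ω → ℝ} {s : Set ℤ} {k i : ℕ}
    (h : ∀ j : Fin k, (((i + j : ℕ) : ℤ) + 1) ∈ s) : Measurable[sigmaOf X s] (window X k i) :=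
  @measurable_pi_lambda _ _ _ (sigmaOf X s) _ _ fun j => measurable_sigmaOf (h j)

lemma measure_inter_le_psiStar {g : ℕ} {j : ℤ} {A B : Set Ω} [IsFiniteMeasure μ]
    (hA : MeasurableSet[sigmaOf X (Set.Iic j)] A)
    (hB : MeasurableSet[sigmaOf X (Set.Ici (j + g))] B) :
    μ (A ∩ B) ≤ psiStar μ X g * μ A * μ B := by
  rcases eq_or_ne (μ A) 0 with h0 | h0
  · rw [measure_mono_null Set.inter_subset_left h0]
    exact zero_le
  rcases eq_or_ne (μ B) 0 with h1 | h1
  · rw [measure_mono_null Set.inter_subset_right h1]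
    exact zero_le
  rw [mul_assoc, ← ENNReal.div_le_iff (mul_ne_zero h0 h1)
    (ENNReal.mul_ne_top (measure_ne_top _ _) (measure_ne_top _ _))]
  exact le_sSup ⟨j, A, B, hA, hB, pos_iff_ne_zero.2 h0, pos_iff_ne_zero.2 h1, rfl⟩

/-- The bound on events is an inequality of measures on the past σ-algebra, which integrates `F`;
weighting by `F` then gives an inequality of measures on the future σ-algebra, which integrates `G`.
-/
lemma lintegral_mul_le_psiStar [IsFiniteMeasure μ] (hX : ∀ i, Measurable (X i)) {g : ℕ} {j : ℤ}
    {F G : Ω → ENNReal} (hF : Measurable[sigmaOf X (Set.Iic j)] F)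
    (hG : Measurable[sigmaOf X (Set.Ici (j + g))] G) :
    ∫⁻ ω, F ω * G ω ∂μ ≤ psiStar μ X g * (∫⁻ ω, F ω ∂μ) * ∫⁻ ω, G ω ∂μ := by
  have h1 := sigmaOf_le hX (Set.Iic j)
  have h2 := sigmaOf_le hX (Set.Ici (j + g))
  have hF' : Measurable F := hF.mono h1 le_rfl
  have hG' : Measurable G := hG.mono h2 le_rfl
  have step : ∀ B, MeasurableSet[sigmaOf X (Set.Ici (j + g))] B →
      ∫⁻ ω in B, F ω ∂μ ≤ psiStar μ X g * (∫⁻ ω, F ω ∂μ) * μ B := by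
    intro B hB
    have hle : (μ.restrict B).trim h1 ≤ (psiStar μ X g * μ B) • μ.trim h1 := by
      refine Measure.le_iff.2 fun A hA => ?_
      rw [trim_measurableSet_eq h1 hA, Measure.restrict_apply (h1 _ hA), Measure.smul_apply,
        trim_measurableSet_eq h1 hA, smul_eq_mul, mul_right_comm]
      exact measure_inter_le_psiStar hA hB
    rw [← lintegral_trim h1 hF, ← lintegral_trim h1 hF]
    refine (lintegral_mono' hle le_rfl).trans_eq ?_
    rw [lintegral_smul_measure, smul_eq_mul, mul_right_comm]
  have hle : (μ.withDensity F).trim h2 ≤ (psiStar μ X g * ∫⁻ ω, F ω ∂μ) • μ.trim h2 := by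
    refine Measure.le_iff.2 fun B hB => ?_
    rw [trim_measurableSet_eq h2 hB, withDensity_apply _ (h2 _ hB), Measure.smul_apply,
      trim_measurableSet_eq h2 hB, smul_eq_mul]
    exact step B hB
  have h3 := lintegral_withDensity_eq_lintegral_mul μ hF' hG'
  simp only [Pi.mul_apply] at h3
  rw [← h3, ← lintegral_trim h2 hG, ← lintegral_trim h2 hG]
  refine (lintegral_mono' hle le_rfl).trans_eq ?_
  rw [lintegral_smul_measure, smul_eq_mul]

end mixing

section stationary

variable {μ : Measure Ω} {X : ℤ → Ω → ℝ}

lemma measurable_window (hX : ∀ i, Measurable (X i)) (k i : ℕ) : Measurable (window X k i) :=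
  measurable_pi_lambda _ fun _ => hX _

lemma map_window (hX : ∀ i, Measurable (X i)) (hstat : IsStationary μ X) (k i : ℕ) :
    μ.map (window X k i) = μ.map (window X k 0) := by
  induction i with
  | zero => rfl
  | succ i ih =>
    rw [← ih]
    have hφ : Measurable fun (y : ℤ → ℝ) (j : Fin k) => y (((i + j : ℕ) : ℤ) + 1) :=
      measurable_pi_lambda _ fun _ => measurable_pi_apply _
    have h := congrArg (Measure.map fun (y : ℤ → ℝ) (j : Fin k) => y (((i + j : ℕ) : ℤ) + 1)) hstat
    rw [Measure.map_map hφ (measurable_pi_lambda _ fun _ => hX _),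
      Measure.map_map hφ (measurable_pi_lambda _ fun _ => hX _)] at h
    refine Eq.trans ?_ h
    congr 1
    funext ω j
    simp only [window, Function.comp]
    congr 1
    push_cast
    ring

lemma integral_window (hX : ∀ i, Measurable (X i)) (hstat : IsStationary μ X) {k : ℕ}
    {f : (Fin k → ℝ) → ℝ} (hf : Measurable f) (i : ℕ) :
    ∫ ω, f (window X k i ω) ∂μ = ∫ ω, f (window X k 0 ω) ∂μ := by
  rw [← integral_map (measurable_window hX k i).aemeasurable hf.aestronglyMeasurable,
    ← integral_map (measurable_window hX k 0).aemeasurable hf.aestronglyMeasurable,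
    map_window hX hstat]

variable [IsProbabilityMeasure μ]

lemma integrable_window (hX : ∀ i, Measurable (X i)) {k : ℕ} {f : (Fin k → ℝ) → ℝ}
    (hf : Measurable f) (hf0 : ∀ w, 0 ≤ f w) (hf1 : ∀ w, f w ≤ 1) (i : ℕ) :
    Integrable (fun ω => f (window X k i ω)) μ :=
  Integrable.of_bound (hf.comp (measurable_window hX k i)).aestronglyMeasurable 1
    (ae_of_all _ fun ω => by rw [Real.norm_of_nonneg (hf0 _)]; exact hf1 _)

lemma integrable_window_mul (hX : ∀ i, Measurable (X i)) {k : ℕ} {f : (Fin k → ℝ) → ℝ}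
    (hf : Measurable f) (hf0 : ∀ w, 0 ≤ f w) (hf1 : ∀ w, f w ≤ 1) (i j : ℕ) :
    Integrable (fun ω => f (window X k i ω) * f (window X k j ω)) μ :=
  (integrable_window hX hf hf0 hf1 i).mul_bdd (c := 1)
    (hf.comp (measurable_window hX k j)).aestronglyMeasurable
    (ae_of_all _ fun ω => by rw [Real.norm_of_nonneg (hf0 _)]; exact hf1 _)

lemma integral_window_mul_le (hX : ∀ i, Measurable (X i)) (hstat : IsStationary μ X) {k : ℕ}
    {f : (Fin k → ℝ) → ℝ} (hf : Measurable f) (hf0 : ∀ w, 0 ≤ f w) (hf1 : ∀ w, f w ≤ 1)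
    {g : ℕ} {c : ℝ} (hc : 0 ≤ c) (hg : psiStar μ X g ≤ ENNReal.ofReal c) {i j : ℕ}
    (hij : i + (k + g) ≤ j) :
    ∫ ω, f (window X k i ω) * f (window X k j ω) ∂μ ≤ c * (∫ ω, f (window X k 0 ω) ∂μ) ^ 2 := by
  set a := ∫ ω, f (window X k 0 ω) ∂μ with ha
  have ha0 : 0 ≤ a := integral_nonneg fun _ => hf0 _
  have hfi : Measurable[sigmaOf X (Set.Iic ((i + k : ℕ) : ℤ))]
      fun ω => ENNReal.ofReal (f (window X k i ω)) :=
    hf.ennreal_ofReal.comp (measurable_window_sigmaOf fun t => by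
      have := t.isLt
      simp only [Set.mem_Iic]
      omega)
  have hfj : Measurable[sigmaOf X (Set.Ici (((i + k : ℕ) : ℤ) + (g : ℕ)))]
      fun ω => ENNReal.ofReal (f (window X k j ω)) :=
    hf.ennreal_ofReal.comp (measurable_window_sigmaOf fun t => by
      simp only [Set.mem_Ici]
      omega)
  have hE : ∀ l, ∫⁻ ω, ENNReal.ofReal (f (window X k l ω)) ∂μ = ENNReal.ofReal a := by
    intro l
    rw [← ofReal_integral_eq_lintegral_ofReal (integrable_window hX hf hf0 hf1 l)
      (ae_of_all _ fun _ => hf0 _), integral_window hX hstat hf]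
  have h := lintegral_mul_le_psiStar hX hfi hfj (μ := μ)
  rw [hE, hE] at h
  rw [← ENNReal.ofReal_le_ofReal_iff (by positivity),
    ofReal_integral_eq_lintegral_ofReal (integrable_window_mul hX hf hf0 hf1 i j)
      (ae_of_all _ fun _ => mul_nonneg (hf0 _) (hf0 _))]
  simp only [ENNReal.ofReal_mul (hf0 _)]
  refine h.trans ?_
  rw [ENNReal.ofReal_mul hc, pow_two, ENNReal.ofReal_mul ha0, ← mul_assoc]
  gcongr

/-- Pairs of windows at least `k + g` apart are almost uncorrelated from above by mixing. Each of
the other pairs contributes at most $1$, and there are at most `2 * (k + g) + 1` of them per row. -/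
lemma integral_sum_window_sq_le (hX : ∀ i, Measurable (X i)) (hstat : IsStationary μ X) {k : ℕ}
    {f : (Fin k → ℝ) → ℝ} (hf : Measurable f) (hf0 : ∀ w, 0 ≤ f w) (hf1 : ∀ w, f w ≤ 1)
    {g : ℕ} {c : ℝ} (hc : 0 ≤ c) (hg : psiStar μ X g ≤ ENNReal.ofReal c) (n : ℕ) :
    ∫ ω, (∑ i ∈ Finset.range n, f (window X k i ω)) ^ 2 ∂μ
      ≤ c * (n * ∫ ω, f (window X k 0 ω) ∂μ) ^ 2 + n * (2 * (k + g) + 1) := by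
  set a := ∫ ω, f (window X k 0 ω) ∂μ with ha
  set K := k + g with hK
  have hpair : ∀ i j : ℕ, ∫ ω, f (window X k i ω) * f (window X k j ω) ∂μ
      ≤ c * a ^ 2 + if j ∈ Finset.Icc (i - K) (i + K) then 1 else 0 := by
    intro i j
    have hca : 0 ≤ c * a ^ 2 := by positivity
    by_cases h1 : i + K ≤ j
    · have := integral_window_mul_le hX hstat hf hf0 hf1 hc hg h1
      split_ifs <;> linarith
    by_cases h2 : j + K ≤ i
    · have := integral_window_mul_le hX hstat hf hf0 hf1 hc hg h2
      simp only [mul_comm (f (window X k j _))] at this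
      split_ifs <;> linarith
    rw [if_pos (Finset.mem_Icc.2 ⟨by omega, by omega⟩)]
    have : ∫ ω, f (window X k i ω) * f (window X k j ω) ∂μ ≤ ∫ _, (1 : ℝ) ∂μ :=
      integral_mono (integrable_window_mul hX hf hf0 hf1 i j) (integrable_const _)
        fun ω => mul_le_one₀ (hf1 _) (hf0 _) (hf1 _)
    simp only [integral_const, probReal_univ, smul_eq_mul, mul_one] at this
    linarith
  simp only [pow_two (∑ i ∈ Finset.range n, f (window X k i _)), Finset.sum_mul_sum]
  rw [integral_finsetSum _ fun i _ => integrable_finsetSum _ fun j _ =>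
    integrable_window_mul hX hf hf0 hf1 i j]
  have hrow : ∀ i ∈ Finset.range n,
      ∫ ω, ∑ j ∈ Finset.range n, f (window X k i ω) * f (window X k j ω) ∂μ
        ≤ n * (c * a ^ 2) + (2 * K + 1) := by
    intro i _
    rw [integral_finsetSum _ fun j _ => integrable_window_mul hX hf hf0 hf1 i j]
    refine (Finset.sum_le_sum fun j _ => hpair i j).trans ?_
    rw [Finset.sum_add_distrib, Finset.sum_const, Finset.card_range, nsmul_eq_mul,
      Finset.sum_boole]
    refine add_le_add_right ?_ _
    have h1 : ((Finset.range n).filter fun j => j ∈ Finset.Icc (i - K) (i + K)).card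
        ≤ (Finset.Icc (i - K) (i + K)).card :=
      Finset.card_le_card fun j hj => (Finset.mem_filter.1 hj).2
    rw [Nat.card_Icc] at h1
    have h2 : ((Finset.range n).filter fun j => j ∈ Finset.Icc (i - K) (i + K)).card
        ≤ 2 * K + 1 := by omega
    exact_mod_cast h2
  refine (Finset.sum_le_sum hrow).trans_eq ?_
  rw [Finset.sum_const, Finset.card_range, nsmul_eq_mul, hK]
  push_cast
  ring

/-- Chebyshev's inequality; an upper bound on $\psi^*$ suffices, since only the second moment must
be bounded above. -/
lemma measure_sum_window_ge_le (hX : ∀ i, Measurable (X i)) (hstat : IsStationary μ X) {k : ℕ}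
    {f : (Fin k → ℝ) → ℝ} (hf : Measurable f) (hf0 : ∀ w, 0 ≤ f w) (hf1 : ∀ w, f w ≤ 1)
    {g : ℕ} {η : ℝ} (hη : 0 ≤ η) (hg : psiStar μ X g ≤ ENNReal.ofReal (1 + η)) {n : ℕ}
    (hn : 0 < n) {t : ℝ} (ht : 0 < t) :
    μ.real {ω | n * (∫ ω, f (window X k 0 ω) ∂μ + t) ≤ ∑ i ∈ Finset.range n, f (window X k i ω)}
      ≤ (η + (2 * (k + g) + 1) / n) / t ^ 2 := by
  set a := ∫ ω, f (window X k 0 ω) ∂μ with ha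
  have hn' : (0 : ℝ) < n := by exact_mod_cast hn
  have ha0 : 0 ≤ a := integral_nonneg fun _ => hf0 _
  have ha1 : a ≤ 1 := by
    have : a ≤ ∫ _, (1 : ℝ) ∂μ :=
      integral_mono (integrable_window hX hf hf0 hf1 0) (integrable_const _) fun ω => hf1 _
    simpa using this
  set T : Ω → ℝ := fun ω => ∑ i ∈ Finset.range n, f (window X k i ω) with hT
  have hTi : Integrable T μ :=
    integrable_finsetSum _ fun i _ => integrable_window hX hf hf0 hf1 i
  have hT2 : Integrable (fun ω => T ω ^ 2) μ := by
    simp only [hT, pow_two, Finset.sum_mul_sum]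
    exact integrable_finsetSum _ fun i _ => integrable_finsetSum _ fun j _ =>
      integrable_window_mul hX hf hf0 hf1 i j
  have hTa : ∫ ω, T ω ∂μ = n * a := by
    simp only [hT]
    rw [integral_finsetSum _ fun i _ => integrable_window hX hf hf0 hf1 i]
    simp [integral_window hX hstat hf, ha]
  have hvar : ∫ ω, (T ω - n * a) ^ 2 ∂μ ≤ η * n ^ 2 + n * (2 * (k + g) + 1) := by
    have h1 : ∀ ω, (T ω - n * a) ^ 2 = T ω ^ 2 - 2 * (n * a) * T ω + (n * a) ^ 2 := by
      intro ω; ring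
    simp_rw [h1]
    have hs : Integrable (fun ω => T ω ^ 2 - 2 * (n * a) * T ω) μ := hT2.sub (hTi.const_mul _)
    rw [integral_add hs (integrable_const _),
      integral_sub hT2 (hTi.const_mul _), integral_const_mul, hTa]
    have h2 := integral_sum_window_sq_le hX hstat hf hf0 hf1 (by linarith) hg n
    have h3 : η * (n * a) ^ 2 ≤ η * n ^ 2 := by
      refine mul_le_mul_of_nonneg_left ?_ hη
      refine pow_le_pow_left₀ (by positivity) ?_ 2
      exact mul_le_of_le_one_right hn'.le ha1
    simp only [integral_const, probReal_univ, smul_eq_mul, one_mul]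
    simp only [hT, ← ha] at h2 ⊢
    linarith
  have hsub : {ω | n * (a + t) ≤ T ω} ⊆ {ω | (n * t) ^ 2 ≤ (T ω - n * a) ^ 2} := by
    intro ω hω
    simp only [Set.mem_ofPred_eq] at hω ⊢
    exact pow_le_pow_left₀ (by positivity) (by linarith) 2
  have hint : Integrable (fun ω => (T ω - n * a) ^ 2) μ := by
    have h1 : (fun ω => (T ω - n * a) ^ 2)
        = fun ω => T ω ^ 2 - 2 * (n * a) * T ω + (n * a) ^ 2 := by
      funext ω; ring
    rw [h1]
    exact (hT2.sub (hTi.const_mul _)).add (integrable_const _)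
  have hm := mul_meas_ge_le_integral_of_nonneg (μ := μ) (ae_of_all _ fun ω => sq_nonneg _) hint
    ((n * t) ^ 2)
  refine (measureReal_mono hsub).trans ?_
  rw [le_div_iff₀ (by positivity)]
  have h5 : (n : ℝ) ^ 2 * (μ.real {ω | (n * t) ^ 2 ≤ (T ω - n * a) ^ 2} * t ^ 2)
      ≤ n ^ 2 * (η + (2 * (k + g) + 1) / n) := by
    have : (n : ℝ) ^ 2 * (η + (2 * (k + g) + 1) / n) = η * n ^ 2 + n * (2 * (k + g) + 1) := by
      field_simp
    rw [this]
    refine le_trans (le_of_eq ?_) (hm.trans hvar)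
    ring
  exact le_of_mul_le_mul_left h5 (by positivity)

/-- A weak law of large numbers that is uniform over functions of a window. -/
lemma eventually_measure_sum_window_ge_le (hX : ∀ i, Measurable (X i))
    (hstat : IsStationary μ X) (hmix : IsPsiStarMixing μ X) (k : ℕ) {t ε : ℝ} (ht : 0 < t)
    (hε : 0 < ε) : ∀ᶠ n : ℕ in atTop, ∀ f : (Fin k → ℝ) → ℝ, Measurable f → (∀ w, 0 ≤ f w) →
      (∀ w, f w ≤ 1) →
      μ.real {ω | n * (∫ ω, f (window X k 0 ω) ∂μ + t)
        ≤ ∑ i ∈ Finset.range n, f (window X k i ω)} ≤ ε := by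
  set η : ℝ := ε * t ^ 2 / 2 with hη
  have hη0 : 0 < η := by positivity
  have hψ : ∀ᶠ g in atTop, psiStar μ X g < ENNReal.ofReal (1 + η) :=
    hmix.eventually_lt_const (by rw [ENNReal.one_lt_ofReal]; linarith)
  -- The gap `g` is fixed before `n` grows and depends on no `f`; this is the source of the
  -- uniformity.
  obtain ⟨g, hg⟩ := hψ.exists
  have hlim : Tendsto (fun n : ℕ => (2 * ((k : ℝ) + g) + 1) / n) atTop (𝓝 0) :=
    tendsto_const_div_atTop_nhds_zero_nat _
  filter_upwards [hlim.eventually_le_const hη0, eventually_gt_atTop 0] with n hn hn0 f hf hf0 hf1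
  refine (measure_sum_window_ge_le hX hstat hf hf0 hf1 hη0.le hg.le hn0 ht).trans ?_
  rw [div_le_iff₀ (by positivity)]
  linarith

end stationary

end CS

/-! ### The quantized source and its information dimension. -/

namespace CS

/-- The quantized alphabet as a finite set. -/
noncomputable def quantFinset (b : ℕ) : Finset ℝ :=
  (Finset.range (2 ^ b + 1)).image fun i : ℕ => (i : ℝ) / 2 ^ b

lemma quant_mem_quantFinset {b : ℕ} {x : ℝ} (hx : x ∈ Set.Icc (0 : ℝ) 1) :
    quant b x ∈ quantFinset b := by
  have h0 : (0 : ℤ) ≤ ⌊(2 : ℝ) ^ b * x⌋ := Int.floor_nonneg.2 (mul_nonneg (by positivity) hx.1)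
  have h1 : ⌊(2 : ℝ) ^ b * x⌋ ≤ 2 ^ b := by
    have h2 : (2 : ℝ) ^ b * x ≤ 2 ^ b := mul_le_of_le_one_right (by positivity) hx.2
    have h3 := (Int.floor_le _).trans h2
    exact_mod_cast h3
  refine Finset.mem_image.2 ⟨⌊(2 : ℝ) ^ b * x⌋.toNat, Finset.mem_range.2 ?_, ?_⟩
  · zify
    rw [Int.toNat_of_nonneg h0]
    linarith
  · rw [quant]
    congr 1
    exact_mod_cast congrArg (Int.cast (R := ℝ)) (Int.toNat_of_nonneg h0)

lemma mem_quantAlphabet_iff {b : ℕ} {x : ℝ} : x ∈ quantAlphabet b ↔ x ∈ quantFinset b := by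
  constructor
  · rintro ⟨y, hy, rfl⟩
    exact quant_mem_quantFinset hy
  · intro h
    obtain ⟨i, hi, rfl⟩ := Finset.mem_image.1 h
    have hi' : (i : ℝ) ≤ 2 ^ b := by exact_mod_cast Nat.lt_succ_iff.1 (Finset.mem_range.1 hi)
    refine ⟨(i : ℝ) / 2 ^ b, ⟨by positivity, div_le_one_of_le₀ hi' (by positivity)⟩, ?_⟩
    have h2 : (2 : ℝ) ^ b * (i / 2 ^ b) = i := by field_simp
    simp [quant, h2]

lemma card_quantFinset_le (b : ℕ) : (quantFinset b).card ≤ 2 ^ (b + 1) := by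
  refine Finset.card_image_le.trans ?_
  rw [Finset.card_range, pow_succ]
  have := Nat.one_le_two_pow (n := b)
  omega

lemma card_quantFinset_pos (b : ℕ) : 0 < (quantFinset b).card :=
  Finset.card_pos.2 ⟨quant b 0, quant_mem_quantFinset ⟨le_rfl, zero_le_one⟩⟩

/-- Entrywise quantization. -/
noncomputable def quantVec (b : ℕ) {k : ℕ} (w : Fin k → ℝ) : Fin k → ℝ := fun j => quant b (w j)

/-- Quantization factors through the countable set of integer vectors, so `g` may be arbitrary. -/
lemma measurable_comp_quantVec (b : ℕ) {k : ℕ} (g : (Fin k → ℝ) → ℝ) :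
    Measurable fun w : Fin k → ℝ => g (quantVec b w) := by
  have h1 : Measurable fun (w : Fin k → ℝ) (j : Fin k) => ⌊(2 : ℝ) ^ b * w j⌋ :=
    measurable_pi_lambda _ fun j => ((measurable_pi_apply j).const_mul _).floor
  exact (measurable_of_countable fun z : Fin k → ℤ => g fun j => (z j : ℝ) / 2 ^ b).comp h1

variable {Ω : Type*} [MeasurableSpace Ω] {μ : Measure Ω} {X : ℤ → Ω → ℝ}

lemma quantVec_window_mem_tuples {Ω : Type*} {X : ℤ → Ω → ℝ} (hX : ∀ i ω, X i ω ∈ Set.Icc (0 : ℝ) 1)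
    (b k i : ℕ) (ω : Ω) :
    quantVec b (window X k i ω) ∈ tuples (quantFinset b) k :=
  Fintype.mem_piFinset.2 fun _ => quant_mem_quantFinset (hX _ _)

lemma quantDist_eq (b k : ℕ) (a : Fin k → ℝ) :
    quantDist μ X b k a = μ.real {ω | quantVec b (window X k 0 ω) = a} := by
  unfold quantDist
  congr 1
  ext ω
  simp [funext_iff, quantVec, window]

lemma quantDist_nonneg (b k : ℕ) (a : Fin k → ℝ) : 0 ≤ quantDist μ X b k a := measureReal_nonneg

lemma quantDist_eq_zero (hX : ∀ i ω, X i ω ∈ Set.Icc (0 : ℝ) 1) {b k : ℕ} {a : Fin k → ℝ}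
    (ha : a ∉ tuples (quantFinset b) k) : quantDist μ X b k a = 0 := by
  rw [quantDist_eq]
  convert measureReal_empty
  refine Set.eq_empty_of_forall_notMem fun ω hω => ha ?_
  rw [← show quantVec b (window X k 0 ω) = a from hω]
  exact quantVec_window_mem_tuples hX b k 0 ω

lemma measurableSet_quantVec_window (hXm : ∀ i, Measurable (X i)) (b k i : ℕ) (a : Fin k → ℝ) :
    MeasurableSet {ω | quantVec b (window X k i ω) = a} := by
  classical
  have h := (measurable_comp_quantVec b fun w : Fin k → ℝ => if w = a then (1 : ℝ) else 0).comp
    (measurable_window hXm k i)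
  have h2 := h (measurableSet_singleton (1 : ℝ))
  convert h2 using 1
  ext ω
  simp

lemma sum_quantDist_mul [IsProbabilityMeasure μ] (hXm : ∀ i, Measurable (X i))
    (hX : ∀ i ω, X i ω ∈ Set.Icc (0 : ℝ) 1) (b k : ℕ) (g : (Fin k → ℝ) → ℝ) :
    ∑ a ∈ tuples (quantFinset b) k, quantDist μ X b k a * g a
      = ∫ ω, g (quantVec b (window X k 0 ω)) ∂μ := by
  have h : ∀ ω, g (quantVec b (window X k 0 ω)) = ∑ a ∈ tuples (quantFinset b) k,
      Set.indicator {ω | quantVec b (window X k 0 ω) = a} (fun _ => g a) ω := by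
    intro ω
    rw [Finset.sum_eq_single_of_mem _ (quantVec_window_mem_tuples hX b k 0 ω)]
    · simp
    · intro a _ ha
      exact Set.indicator_of_notMem (fun h => ha h.symm) _
  simp_rw [h]
  rw [integral_finsetSum]
  · refine Finset.sum_congr rfl fun a _ => ?_
    rw [integral_indicator_const _ (measurableSet_quantVec_window hXm b k 0 a), quantDist_eq,
      smul_eq_mul]
  · intro a _
    exact (integrable_const _).indicator (measurableSet_quantVec_window hXm b k 0 a)

lemma condEntropyLast_quantDist_eq [IsProbabilityMeasure μ] (hXm : ∀ i, Measurable (X i))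
    (hX : ∀ i ω, X i ω ∈ Set.Icc (0 : ℝ) 1) (b k : ℕ) :
    condEntropyLast (quantDist μ X b (k + 1)) = ∫ ω, -Real.logb 2 (kernelOf (quantFinset b)
      (quantDist μ X b (k + 1)) (quantVec b (window X (k + 1) 0 ω))) ∂μ := by
  rw [condEntropyLast_eq_sum (S := quantFinset b) fun u hu => quantDist_eq_zero hX hu]
  exact sum_quantDist_mul hXm hX b (k + 1) fun u =>
    -Real.logb 2 (kernelOf (quantFinset b) (quantDist μ X b (k + 1)) u)

lemma quantDist_eq_shift [IsProbabilityMeasure μ] (hXm : ∀ i, Measurable (X i))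
    (hstat : IsStationary μ X) (b k i : ℕ) (a : Fin k → ℝ) :
    quantDist μ X b k a = μ.real {ω | quantVec b (window X k i ω) = a} := by
  classical
  have h := integral_window (μ := μ) hXm hstat
    (measurable_comp_quantVec b fun w : Fin k → ℝ => if w = a then (1 : ℝ) else 0) i
  have h2 : ∀ l, ∫ ω, (if quantVec b (window X k l ω) = a then (1 : ℝ) else 0) ∂μ
      = μ.real {ω | quantVec b (window X k l ω) = a} := by
    intro l
    rw [← integral_indicator_one (measurableSet_quantVec_window hXm b k l a)]
    simp only [Set.indicator_apply, Set.mem_ofPred_eq, Pi.one_apply]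
  rw [quantDist_eq, ← h2, ← h2, h]

lemma quantVec_window_natAdd {Ω : Type*} {X : ℤ → Ω → ℝ} (b l k : ℕ) (ω : Ω) :
    (fun j : Fin (k + 1) => quantVec b (window X (l + k + 1) 0 ω) (Fin.natAdd l j))
      = quantVec b (window X (k + 1) l ω) := by
  funext j
  simp [quantVec, window]

/-- Conditioning reduces entropy: Gibbs' inequality with the shorter-context kernel, followed by
stationarity to move the window back to the origin. -/
lemma condEntropyLast_quantDist_add_le [IsProbabilityMeasure μ] (hXm : ∀ i, Measurable (X i))
    (hX : ∀ i ω, X i ω ∈ Set.Icc (0 : ℝ) 1) (hstat : IsStationary μ X) (b l k : ℕ) :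
    condEntropyLast (quantDist μ X b (l + k + 1)) ≤ condEntropyLast (quantDist μ X b (k + 1)) := by
  set r := kernelOf (quantFinset b) (quantDist μ X b (k + 1)) with hr
  have h := condEntropyLast_le_sum (S := quantFinset b) (p := quantDist μ X b (l + k + 1))
    (r := fun u => r fun j : Fin (k + 1) => u (Fin.natAdd l j)) (quantDist_nonneg b _)
    (fun u hu => quantDist_eq_zero hX hu)
    (fun _ => kernelOf_nonneg _ (quantDist_nonneg b _) _)
    (fun c => by
      simpa only [snocR_comp_natAdd] using sum_kernelOf_le_one (quantFinset b)
        (quantDist μ X b (k + 1)) fun j => c (Fin.natAdd l j))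
    (fun u hu => by
      have hle : quantDist μ X b (l + k + 1) u
          ≤ quantDist μ X b (k + 1) fun j : Fin (k + 1) => u (Fin.natAdd l j) := by
        rw [quantDist_eq, quantDist_eq_shift hXm hstat b (k + 1) l]
        refine measureReal_mono fun ω hω => ?_
        have hω' : quantVec b (window X (l + k + 1) 0 ω) = u := hω
        rw [Set.mem_ofPred_eq, ← quantVec_window_natAdd, hω']
      have hpos := hu.trans_le hle
      refine kernelOf_pos (quantDist_nonneg b _) ?_ hpos
      by_contra hmem
      exact hpos.ne' (quantDist_eq_zero hX hmem))
  refine h.trans_eq ?_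
  rw [sum_quantDist_mul hXm hX b (l + k + 1) fun u : Fin (l + k + 1) → ℝ =>
    -Real.logb 2 (r fun j : Fin (k + 1) => u (Fin.natAdd l j)),
    condEntropyLast_quantDist_eq hXm hX]
  simp only [quantVec_window_natAdd]
  exact integral_window hXm hstat (measurable_comp_quantVec b fun w => -Real.logb 2 (r w)) l

/-- The mixture, with equal weights, of the conditional distribution of the last quantized entry
and the uniform distribution on the alphabet. -/
noncomputable def mixKernel (μ : Measure Ω) (X : ℤ → Ω → ℝ) (b k : ℕ) (u : Fin (k + 1) → ℝ) : ℝ :=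
  (kernelOf (quantFinset b) (quantDist μ X b (k + 1)) u + ((quantFinset b).card : ℝ)⁻¹) / 2

lemma mixKernel_pos (b k : ℕ) (u : Fin (k + 1) → ℝ) : 0 < mixKernel μ X b k u := by
  have h1 := kernelOf_nonneg (quantFinset b) (quantDist_nonneg (μ := μ) (X := X) b (k + 1)) u
  have h2 : (0 : ℝ) < (quantFinset b).card := by exact_mod_cast card_quantFinset_pos b
  unfold mixKernel
  positivity

lemma sum_mixKernel_le_one (b k : ℕ) (c : Fin k → ℝ) :
    ∑ s ∈ quantFinset b, mixKernel μ X b k (snocR c s) ≤ 1 := by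
  have h1 := sum_kernelOf_le_one (quantFinset b) (quantDist μ X b (k + 1)) c
  have h2 : ((quantFinset b).card : ℝ) ≠ 0 := by exact_mod_cast (card_quantFinset_pos b).ne'
  simp only [mixKernel]
  rw [← Finset.sum_div, Finset.sum_add_distrib, Finset.sum_const, nsmul_eq_mul, mul_inv_cancel₀ h2]
  linarith

lemma mixKernel_le_one (hX : ∀ i ω, X i ω ∈ Set.Icc (0 : ℝ) 1) (b k : ℕ) (u : Fin (k + 1) → ℝ) :
    mixKernel μ X b k u ≤ 1 := by
  have h1 : kernelOf (quantFinset b) (quantDist μ X b (k + 1)) u ≤ 1 := by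
    by_cases hu : u ∈ tuples (quantFinset b) (k + 1)
    · exact kernelOf_le_one (quantDist_nonneg b _) hu
    · rw [kernelOf, quantDist_eq_zero hX hu, zero_div]
      exact zero_le_one
  have h2 : ((quantFinset b).card : ℝ)⁻¹ ≤ 1 :=
    inv_le_one_of_one_le₀ (by exact_mod_cast card_quantFinset_pos b)
  unfold mixKernel
  linarith

lemma neg_logb_mixKernel_nonneg (hX : ∀ i ω, X i ω ∈ Set.Icc (0 : ℝ) 1) (b k : ℕ)
    (u : Fin (k + 1) → ℝ) : 0 ≤ -Real.logb 2 (mixKernel μ X b k u) :=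
  neg_nonneg.2 (Real.logb_nonpos one_lt_two (mixKernel_pos b k u).le (mixKernel_le_one hX b k u))

/-- The uniform component leaves every symbol mass at least $1/(2|S|)\ge 2^{-(b+2)}$. Bounded code
lengths are what the law of large numbers needs. -/
lemma neg_logb_mixKernel_le (b k : ℕ) (u : Fin (k + 1) → ℝ) :
    -Real.logb 2 (mixKernel μ X b k u) ≤ b + 2 := by
  have h1 := kernelOf_nonneg (quantFinset b) (quantDist_nonneg (μ := μ) (X := X) b (k + 1)) u
  have h2 : (0 : ℝ) < (quantFinset b).card := by exact_mod_cast card_quantFinset_pos b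
  have h3 : ((quantFinset b).card : ℝ) ≤ 2 ^ (b + 1) := by exact_mod_cast card_quantFinset_le b
  have h4 : ((2 : ℝ) ^ (b + 2))⁻¹ ≤ mixKernel μ X b k u := by
    have h5 := inv_anti₀ h2 h3
    have h6 : ((2 : ℝ) ^ (b + 2))⁻¹ = ((2 : ℝ) ^ (b + 1))⁻¹ / 2 := by
      rw [pow_succ (2 : ℝ) (b + 1), mul_inv, div_eq_mul_inv]
    unfold mixKernel
    linarith
  have h7 := Real.logb_le_logb_of_le one_lt_two (by positivity) h4
  rw [Real.logb_inv, Real.logb_pow, Real.logb_self_eq_one one_lt_two] at h7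
  push_cast at h7
  linarith

lemma sum_quantDist [IsProbabilityMeasure μ] (hXm : ∀ i, Measurable (X i))
    (hX : ∀ i ω, X i ω ∈ Set.Icc (0 : ℝ) 1) (b k : ℕ) :
    ∑ a ∈ tuples (quantFinset b) k, quantDist μ X b k a = 1 := by
  simpa using sum_quantDist_mul (μ := μ) hXm hX b k fun _ => 1

/-- The mixture is at least half the true kernel, which costs one extra bit. -/
lemma integral_neg_logb_mixKernel_le [IsProbabilityMeasure μ] (hXm : ∀ i, Measurable (X i))
    (hX : ∀ i ω, X i ω ∈ Set.Icc (0 : ℝ) 1) (b k : ℕ) :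
    ∫ ω, -Real.logb 2 (mixKernel μ X b k (quantVec b (window X (k + 1) 0 ω))) ∂μ
      ≤ 1 + condEntropyLast (quantDist μ X b (k + 1)) := by
  rw [← sum_quantDist_mul hXm hX b (k + 1) fun u => -Real.logb 2 (mixKernel μ X b k u),
    condEntropyLast_eq_sum (S := quantFinset b) fun u hu => quantDist_eq_zero hX hu,
    ← sum_quantDist (μ := μ) hXm hX b (k + 1), ← Finset.sum_add_distrib]
  refine Finset.sum_le_sum fun u hu => ?_
  rcases (quantDist_nonneg (μ := μ) (X := X) b (k + 1) u).eq_or_lt with h0 | h0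
  · simp [← h0]
  have hk := kernelOf_pos (quantDist_nonneg (μ := μ) (X := X) b (k + 1)) hu h0
  have h1 : kernelOf (quantFinset b) (quantDist μ X b (k + 1)) u / 2 ≤ mixKernel μ X b k u := by
    unfold mixKernel
    have : (0 : ℝ) ≤ ((quantFinset b).card : ℝ)⁻¹ := by positivity
    linarith
  have h2 := Real.logb_le_logb_of_le one_lt_two (by positivity) h1
  rw [Real.logb_div hk.ne' two_ne_zero, Real.logb_self_eq_one one_lt_two] at h2
  have h3 := mul_le_mul_of_nonneg_left h2 h0.le
  linarith

lemma condEntropyLast_quantDist_le [IsProbabilityMeasure μ] (hXm : ∀ i, Measurable (X i))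
    (hX : ∀ i ω, X i ω ∈ Set.Icc (0 : ℝ) 1) (b k : ℕ) :
    condEntropyLast (quantDist μ X b (k + 1)) ≤ b + 2 := by
  refine (condEntropyLast_le_sum (S := quantFinset b) (r := mixKernel μ X b k)
    (quantDist_nonneg b _) (fun u hu => quantDist_eq_zero hX hu)
    (fun u => (mixKernel_pos b k u).le) (sum_mixKernel_le_one b k)
    fun u _ => mixKernel_pos b k u).trans ?_
  refine (Finset.sum_le_sum fun u _ => mul_le_mul_of_nonneg_left
    (neg_logb_mixKernel_le b k u) (quantDist_nonneg b _ u)).trans_eq ?_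
  rw [← Finset.sum_mul, sum_quantDist hXm hX, one_mul]

lemma condEntropyLast_quantDist_nonneg (hX : ∀ i ω, X i ω ∈ Set.Icc (0 : ℝ) 1) (b k : ℕ) :
    0 ≤ condEntropyLast (quantDist μ X b (k + 1)) :=
  condEntropyLast_nonneg (S := quantFinset b) (quantDist_nonneg b _)
    fun _ hu => quantDist_eq_zero hX hu

/-- A real `limsup` is meaningful only for bounded sequences. -/
lemma isBoundedUnder_condEntropyLast_div [IsProbabilityMeasure μ] (hXm : ∀ i, Measurable (X i))
    (hX : ∀ i ω, X i ω ∈ Set.Icc (0 : ℝ) 1) (k : ℕ) :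
    IsBoundedUnder (· ≤ ·) atTop
      fun b : ℕ => condEntropyLast (quantDist μ X b (k + 1)) / (b : ℝ) := by
  refine isBoundedUnder_of_eventually_le (a := 3) ?_
  filter_upwards [eventually_ge_atTop 1] with b hb
  have hb' : (1 : ℝ) ≤ b := by exact_mod_cast hb
  rw [div_le_iff₀ (by linarith)]
  have := condEntropyLast_quantDist_le (μ := μ) hXm hX b k
  linarith

lemma isBoundedUnder_ge_condEntropyLast_div (hX : ∀ i ω, X i ω ∈ Set.Icc (0 : ℝ) 1) (k : ℕ) :
    IsBoundedUnder (· ≥ ·) atTop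
      fun b : ℕ => condEntropyLast (quantDist μ X b (k + 1)) / (b : ℝ) :=
  isBoundedUnder_of_eventually_ge (a := 0) (Eventually.of_forall fun b =>
    div_nonneg (condEntropyLast_quantDist_nonneg hX b k) (Nat.cast_nonneg b))

lemma upperInfoDimOrder_nonneg [IsProbabilityMeasure μ] (hXm : ∀ i, Measurable (X i))
    (hX : ∀ i ω, X i ω ∈ Set.Icc (0 : ℝ) 1) (k : ℕ) : 0 ≤ upperInfoDimOrder μ X k :=
  le_limsup_of_frequently_le (Eventually.of_forall fun b =>
    div_nonneg (condEntropyLast_quantDist_nonneg hX b k) (Nat.cast_nonneg b)).frequently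
    (isBoundedUnder_condEntropyLast_div hXm hX k)

lemma antitone_upperInfoDimOrder [IsProbabilityMeasure μ] (hXm : ∀ i, Measurable (X i))
    (hX : ∀ i ω, X i ω ∈ Set.Icc (0 : ℝ) 1) (hstat : IsStationary μ X) :
    Antitone (upperInfoDimOrder μ X) := by
  intro k k' h
  obtain ⟨l, rfl⟩ := Nat.exists_eq_add_of_le' h
  refine limsup_le_limsup (Eventually.of_forall fun b => ?_)
    (isBoundedUnder_ge_condEntropyLast_div hX _).isCoboundedUnder_le
    (isBoundedUnder_condEntropyLast_div hXm hX k)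
  exact div_le_div_of_nonneg_right (condEntropyLast_quantDist_add_le hXm hX hstat b l k)
    (Nat.cast_nonneg b)

/-- The orders decrease and are nonnegative, so the limit behind `limUnder` exists and is not a
default value. -/
lemma tendsto_upperInfoDimOrder [IsProbabilityMeasure μ] (hXm : ∀ i, Measurable (X i))
    (hX : ∀ i ω, X i ω ∈ Set.Icc (0 : ℝ) 1) (hstat : IsStationary μ X) :
    Tendsto (upperInfoDimOrder μ X) atTop (𝓝 (upperInfoDim μ X)) := by
  have h := tendsto_atTop_ciInf (antitone_upperInfoDimOrder (μ := μ) hXm hX hstat)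
    ⟨0, by rintro _ ⟨k, rfl⟩; exact upperInfoDimOrder_nonneg hXm hX k⟩
  have h2 : upperInfoDim μ X = ⨅ k, upperInfoDimOrder μ X k := h.limUnder_eq
  rwa [h2]

lemma upperInfoDim_nonneg [IsProbabilityMeasure μ] (hXm : ∀ i, Measurable (X i))
    (hX : ∀ i ω, X i ω ∈ Set.Icc (0 : ℝ) 1) (hstat : IsStationary μ X) :
    0 ≤ upperInfoDim μ X :=
  ge_of_tendsto' (tendsto_upperInfoDimOrder hXm hX hstat) (upperInfoDimOrder_nonneg hXm hX)

lemma exists_eventually_condEntropyLast_le [IsProbabilityMeasure μ] (hXm : ∀ i, Measurable (X i))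
    (hX : ∀ i ω, X i ω ∈ Set.Icc (0 : ℝ) 1) (hstat : IsStationary μ X) {d : ℝ}
    (hd : upperInfoDim μ X < d) :
    ∃ k, ∀ᶠ b : ℕ in atTop, condEntropyLast (quantDist μ X b (k + 1)) ≤ d * b := by
  obtain ⟨k, hk⟩ := ((tendsto_upperInfoDimOrder hXm hX hstat).eventually_lt_const hd).exists
  refine ⟨k, ?_⟩
  filter_upwards [eventually_lt_of_limsup_lt hk (isBoundedUnder_condEntropyLast_div hXm hX k),
    eventually_gt_atTop 0] with b hb hb0
  rw [div_lt_iff₀ (by exact_mod_cast hb0)] at hb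
  exact hb.le

lemma cycWindow_quantVec_block {Ω : Type*} {X : ℤ → Ω → ℝ} {n : ℕ} (hn : 0 < n) (b : ℕ)
    {k i : ℕ} (h : i + k ≤ n) (ω : Ω) :
    cycWindow hn (quantVec b (block X n ω)) k i = quantVec b (window X k i ω) := by
  funext j
  have hj := j.isLt
  have h1 : (i + (j : ℕ)) % n = i + j := Nat.mod_eq_of_lt (by omega)
  simp [cycWindow, quantVec, window, block, h1]

/-- Cyclic windows of the block agree with windows of the process unless they wrap around; fewer
than `k + 1` do, each costing at most `b + 2` bits. -/
lemma condEmpEntropy_quantVec_block_le (hX : ∀ i ω, X i ω ∈ Set.Icc (0 : ℝ) 1) {n : ℕ}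
    (hn : 0 < n) (b l k : ℕ) (ω : Ω) :
    condEmpEntropy (l + k) (quantVec b (block X n ω))
      ≤ (∑ i ∈ Finset.range n,
          -Real.logb 2 (mixKernel μ X b k (quantVec b (window X (k + 1) i ω)))) / n
        + (k + 1) * (b + 2) / n := by
  have h := condEmpEntropy_le_sum hn (x := quantVec b (block X n ω)) (S := quantFinset b)
    (fun i => quant_mem_quantFinset (hX _ _)) l (k := k) (r := mixKernel μ X b k)
    (fun u => (mixKernel_pos b k u).le) (sum_mixKernel_le_one b k) (fun u _ => mixKernel_pos b k u)
  refine h.trans ?_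
  rw [← add_div]
  refine div_le_div_of_nonneg_right ?_ (Nat.cast_nonneg n)
  have hterm : ∀ i ∈ Finset.range n,
      -Real.logb 2 (mixKernel μ X b k (cycWindow hn (quantVec b (block X n ω)) (k + 1) i))
        ≤ -Real.logb 2 (mixKernel μ X b k (quantVec b (window X (k + 1) i ω)))
          + if i ∈ Finset.Ico (n - (k + 1)) n then (b : ℝ) + 2 else 0 := by
    intro i hi
    have hi' := Finset.mem_range.1 hi
    by_cases h1 : i + (k + 1) ≤ n
    · rw [cycWindow_quantVec_block hn b h1]
      refine le_add_of_nonneg_right ?_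
      split_ifs <;> positivity
    · rw [if_pos (Finset.mem_Ico.2 ⟨by omega, hi'⟩)]
      have h2 := neg_logb_mixKernel_le (μ := μ) (X := X) b k
        (cycWindow hn (quantVec b (block X n ω)) (k + 1) i)
      have h3 := neg_logb_mixKernel_nonneg (μ := μ) hX b k (quantVec b (window X (k + 1) i ω))
      linarith
  refine (Finset.sum_le_sum hterm).trans ?_
  rw [Finset.sum_add_distrib]
  refine add_le_add_right ?_ _
  rw [← Finset.sum_filter, Finset.sum_const, nsmul_eq_mul]
  refine mul_le_mul_of_nonneg_right ?_ (by positivity)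
  have h4 : ((Finset.range n).filter fun i => i ∈ Finset.Ico (n - (k + 1)) n).card
      ≤ (Finset.Ico (n - (k + 1)) n).card :=
    Finset.card_le_card fun j hj => (Finset.mem_filter.1 hj).2
  rw [Nat.card_Ico] at h4
  have h5 : ((Finset.range n).filter fun i => i ∈ Finset.Ico (n - (k + 1)) n).card ≤ k + 1 := by
    omega
  exact_mod_cast h5

/-- The conditional empirical entropy rate of the quantized source block is asymptotically at most
the upper information dimension. -/
lemma tendsto_measure_condEmpEntropy_gt [IsProbabilityMeasure μ] (hXm : ∀ i, Measurable (X i))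
    (hX : ∀ i ω, X i ω ∈ Set.Icc (0 : ℝ) 1) (hstat : IsStationary μ X)
    (hmix : IsPsiStarMixing μ X) {b k : ℕ → ℕ} (hb : Tendsto b atTop atTop)
    (hk : Tendsto k atTop atTop) {d : ℝ} (hd : upperInfoDim μ X < d) :
    Tendsto (fun n => μ {ω | d * b n < condEmpEntropy (k n) (quantVec (b n) (block X n ω))})
      atTop (𝓝 0) := by
  obtain ⟨d', hd1, hd2⟩ := exists_between hd
  obtain ⟨k₀, hk₀⟩ := exists_eventually_condEntropyLast_le hXm hX hstat hd1
  set t : ℝ := (d - d') / 2 with ht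
  have ht0 : 0 < t := by linarith
  have hbr : Tendsto (fun n => (b n : ℝ)) atTop atTop := tendsto_natCast_atTop_atTop.comp hb
  have hinv : Tendsto (fun n : ℕ => ((k₀ : ℝ) + 1) / n) atTop (𝓝 0) :=
    tendsto_const_div_atTop_nhds_zero_nat _
  rw [ENNReal.tendsto_nhds_zero]
  intro ε hε
  obtain ⟨ε', hε', hεε⟩ : ∃ ε' : ℝ, 0 < ε' ∧ ENNReal.ofReal ε' ≤ ε := by
    rcases eq_or_ne ε ⊤ with rfl | h
    · exact ⟨1, one_pos, le_top⟩
    · exact ⟨ε.toReal, ENNReal.toReal_pos hε.ne' h, ENNReal.ofReal_toReal_le⟩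
  filter_upwards [eventually_measure_sum_window_ge_le (μ := μ) hXm hstat hmix (k₀ + 1)
      (half_pos ht0) hε', hb.eventually hk₀, hk.eventually_ge_atTop k₀, eventually_gt_atTop 0,
      hinv.eventually_le_const (half_pos ht0),
      hbr.eventually_ge_atTop ((1 + 2 * t) / t)] with n hn hE hkn hn0 hkn2 hbn
  have hn' : (0 : ℝ) < n := by exact_mod_cast hn0
  have hb2 : (0 : ℝ) < b n + 2 := by positivity
  -- Division by `b n + 2` brings the code length into $[0,1]$, so the uniform law applies although
  -- `f` varies with `n`.
  set f : (Fin (k₀ + 1) → ℝ) → ℝ := fun w =>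
    -Real.logb 2 (mixKernel μ X (b n) k₀ (quantVec (b n) w)) / (b n + 2) with hf
  have hfm : Measurable f := measurable_comp_quantVec (b n) fun u =>
    -Real.logb 2 (mixKernel μ X (b n) k₀ u) / (b n + 2)
  have h := hn f hfm (fun w => div_nonneg (neg_logb_mixKernel_nonneg hX _ _ _) hb2.le)
    fun w => div_le_one_of_le₀ (neg_logb_mixKernel_le _ _ _) hb2.le
  rw [measureReal_def] at h
  refine le_trans ?_ hεε
  rw [← ENNReal.toReal_le_toReal (measure_ne_top _ _) ENNReal.ofReal_ne_top,
    ENNReal.toReal_ofReal hε'.le]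
  refine le_trans (ENNReal.toReal_mono (measure_ne_top _ _) (measure_mono fun ω hω => ?_)) h
  rw [Set.mem_ofPred_eq] at hω ⊢
  obtain ⟨l, hl⟩ := Nat.exists_eq_add_of_le' hkn
  rw [hl] at hω
  have h1 := hω.trans_le (condEmpEntropy_quantVec_block_le (μ := μ) hX hn0 (b n) l k₀ ω)
  have h2 := integral_neg_logb_mixKernel_le (μ := μ) hXm hX (b n) k₀
  have h3 : ∫ ω, f (window X (k₀ + 1) 0 ω) ∂μ ≤ (1 + d' * b n) / (b n + 2) := by
    simp only [hf]
    rw [integral_div]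
    exact div_le_div_of_nonneg_right (by linarith) hb2.le
  have h4 : ∑ i ∈ Finset.range n, f (window X (k₀ + 1) i ω)
      = (∑ i ∈ Finset.range n, -Real.logb 2 (mixKernel μ X (b n) k₀
          (quantVec (b n) (window X (k₀ + 1) i ω)))) / (b n + 2) := by
    rw [Finset.sum_div]
  rw [h4, le_div_iff₀ hb2]
  set U := ∑ i ∈ Finset.range n, -Real.logb 2 (mixKernel μ X (b n) k₀
          (quantVec (b n) (window X (k₀ + 1) i ω))) with hU
  rw [le_div_iff₀ hb2] at h3
  rw [div_le_iff₀ ht0] at hbn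
  have h5 : ((k₀ : ℝ) + 1) * (b n + 2) / n ≤ t / 2 * (b n + 2) := by
    rw [mul_div_right_comm]
    exact mul_le_mul_of_nonneg_right hkn2 hb2.le
  -- The surplus $d-d'=2t$ pays $t/2$ for the fluctuation and $t/2$ for the wrap-around; the rest,
  -- $tb\ge 1+2t$, covers the extra bit and the two in $b+2$.
  have h6 : (∫ ω, f (window X (k₀ + 1) 0 ω) ∂μ + t / 2) * (b n + 2) ≤ U / n := by
    have : d * b n = d' * b n + 2 * t * b n := by rw [ht]; ring
    nlinarith
  rw [le_div_iff₀ hn'] at h6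
  linarith

end CS

/-! ### Gaussian matrices: moments, lower tails and independence from the source. -/

namespace CS

variable {Ω : Type*} [MeasurableSpace Ω]

/-- The rows of a matrix of independent identically distributed entries are independent. -/
lemma iIndepFun_rows {ι κ : Type*} {μ : Measure Ω} [IsProbabilityMeasure μ]
    {X : ι → κ → Ω → ℝ} {ν : Measure ℝ} [IsProbabilityMeasure ν]
    (hX : ∀ i j, Measurable (X i j)) (hlaw : ∀ i j, μ.map (X i j) = ν)
    (hind : iIndepFun (fun (p : ι × κ) => X p.1 p.2) μ) :
    iIndepFun (fun i ω j => X i j ω) μ := by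
  have h1 : μ.map (fun ω (p : ι × κ) => X p.1 p.2 ω) = Measure.infinitePi fun _ : ι × κ => ν := by
    have h := hind.map_fun_eq_infinitePi_map fun p : ι × κ => hX p.1 p.2
    simpa only [hlaw] using h
  have h2 : μ.map (fun ω i j => X i j ω)
      = Measure.infinitePi fun _ : ι => Measure.infinitePi fun _ : κ => ν := by
    rw [← Measure.infinitePi_map_curry (fun (_ : ι) (_ : κ) => ν), ← h1, Measure.map_map]
    · rfl
    · exact (MeasurableEquiv.curry ι κ ℝ).measurable
    · exact measurable_pi_lambda _ fun p => hX p.1 p.2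
  have hm : ∀ i, Measurable fun ω j => X i j ω := fun i => measurable_pi_lambda _ (hX i)
  have h3 : ∀ i, μ.map (fun ω j => X i j ω) = Measure.infinitePi fun _ : κ => ν := by
    intro i
    rw [← Measure.infinitePi_map_eval (fun _ : ι => Measure.infinitePi fun _ : κ => ν) i, ← h2,
      Measure.map_map (measurable_pi_apply i) (measurable_pi_lambda _ hm)]
    rfl
  rw [iIndepFun_iff_map_fun_eq_infinitePi_map hm, h2]
  simp only [h3]

lemma map_sum_mul_gaussian {ι : Type*} {μ : Measure Ω} [IsProbabilityMeasure μ]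
    {G : ι → Ω → ℝ} (hG : ∀ j, Measurable (G j)) (hlaw : ∀ j, μ.map (G j) = gaussianReal 0 1)
    (hind : iIndepFun G μ) (v : ι → ℝ) (s : Finset ι) :
    μ.map (fun ω => ∑ j ∈ s, G j ω * v j) = gaussianReal 0 (∑ j ∈ s, ‖v j‖₊ ^ 2) := by
  classical
  have hind' : iIndepFun (fun j ω => G j ω * v j) μ :=
    hind.comp (fun j x => x * v j) fun j => measurable_id.mul_const _
  have hm : ∀ j, Measurable fun ω => G j ω * v j := fun j => (hG j).mul_const _
  induction s using Finset.induction_on with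
  | empty => simp
  | insert a s ha ih =>
    have h1 : μ.map (fun ω => G a ω * v a) = gaussianReal 0 (‖v a‖₊ ^ 2) := by
      have := gaussianReal_mul_const (P := μ) (X := G a) ⟨(hG a).aemeasurable, hlaw a⟩ (v a)
      rw [this.map_eq]
      congr 1
      · simp
      · ext; simp
    have hi := (hind'.indepFun_finsetSum_of_notMem hm ha).symm
    have h2 := gaussianReal_add_gaussianReal_of_indepFun hi h1 (by
      rw [← ih]
      congr 1
      funext ω
      simp)
    rw [Finset.sum_insert ha]
    convert h2 using 2
    · funext ω
      simp [Finset.sum_insert ha]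
    · simp

lemma integral_exp_neg_sq_gaussian {s : ℝ} (hs : 0 < s) {v : NNReal} (hv : v ≠ 0) :
    ∫ x, Real.exp (-s * x ^ 2) ∂gaussianReal 0 v = (√(1 + 2 * s * v))⁻¹ := by
  have hv' : (0 : ℝ) < v := by positivity
  rw [integral_gaussianReal_eq_integral_smul hv]
  have : ∀ x : ℝ, gaussianPDFReal 0 v x • Real.exp (-s * x ^ 2)
      = (√(2 * Real.pi * v))⁻¹ * Real.exp (-((1 + 2 * s * v) / (2 * v)) * x ^ 2) := by
    intro x
    rw [gaussianPDFReal, smul_eq_mul, mul_assoc, ← Real.exp_add]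
    congr 2
    field_simp
    ring
  simp_rw [this]
  rw [integral_const_mul, integral_gaussian, ← Real.sqrt_inv, ← Real.sqrt_inv,
    ← Real.sqrt_mul (by positivity)]
  congr 1
  field_simp

lemma sum_nnnorm_sq_eq {n : ℕ} (v : Fin n → ℝ) :
    ((∑ j, ‖v j‖₊ ^ 2 : NNReal) : ℝ) = ‖WithLp.toLp 2 v‖ ^ 2 := by
  rw [EuclideanSpace.norm_sq_eq]
  push_cast
  rfl

lemma norm_mulVec_sq {m n : ℕ} (a : Matrix (Fin m) (Fin n) ℝ) (v : Fin n → ℝ) :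
    ‖WithLp.toLp 2 (a.mulVec v)‖ ^ 2 = ∑ i, (∑ j, a i j * v j) ^ 2 := by
  rw [EuclideanSpace.norm_sq_eq]
  simp [Matrix.mulVec, dotProduct]

/-- The entries of a random matrix are independent standard Gaussian variables. -/
structure IsStdGaussianMatrix {m n : ℕ} (μ : Measure Ω) (A : Ω → Matrix (Fin m) (Fin n) ℝ) :
    Prop where
  meas : ∀ i j, Measurable fun ω => A ω i j
  law : ∀ i j, μ.map (fun ω => A ω i j) = gaussianReal 0 1
  indep : iIndepFun (fun (p : Fin m × Fin n) ω => A ω p.1 p.2) μ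

namespace IsStdGaussianMatrix

variable {m n : ℕ} {μ : Measure Ω} {A : Ω → Matrix (Fin m) (Fin n) ℝ}

lemma measurable_row_mul (hA : IsStdGaussianMatrix μ A) (v : Fin n → ℝ) (i : Fin m) :
    Measurable fun ω => ∑ j, A ω i j * v j :=
  Finset.measurable_sum _ fun j _ => (hA.meas i j).mul_const _

variable [IsProbabilityMeasure μ]

lemma map_row_mul (hA : IsStdGaussianMatrix μ A) (v : Fin n → ℝ) (i : Fin m) :
    μ.map (fun ω => ∑ j, A ω i j * v j) = gaussianReal 0 (∑ j, ‖v j‖₊ ^ 2) :=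
  map_sum_mul_gaussian (hA.meas i) (hA.law i)
    (hA.indep.precomp (g := fun j : Fin n => (i, j)) fun _ _ h => (Prod.mk.inj h).2) v Finset.univ

lemma iIndepFun_row_mul_sq (hA : IsStdGaussianMatrix μ A) (v : Fin n → ℝ) :
    iIndepFun (fun (i : Fin m) ω => (∑ j, A ω i j * v j) ^ 2) μ :=
  (iIndepFun_rows (X := fun i j ω => A ω i j) hA.meas hA.law hA.indep).comp
    (fun _ a => (∑ j, a j * v j) ^ 2) fun _ => by fun_prop

lemma lintegral_norm_mulVec_sq (hA : IsStdGaussianMatrix μ A) (v : Fin n → ℝ) :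
    ∫⁻ ω, ENNReal.ofReal (‖WithLp.toLp 2 ((A ω).mulVec v)‖ ^ 2) ∂μ
      = ENNReal.ofReal (m * ‖WithLp.toLp 2 v‖ ^ 2) := by
  simp_rw [norm_mulVec_sq]
  have hrow : ∀ i, ∫⁻ ω, ENNReal.ofReal ((∑ j, A ω i j * v j) ^ 2) ∂μ
      = ENNReal.ofReal (‖WithLp.toLp 2 v‖ ^ 2) := by
    intro i
    have h1 := lintegral_map (μ := μ) (f := fun x : ℝ => ENNReal.ofReal (x ^ 2))
      (g := fun ω => ∑ j, A ω i j * v j) (by fun_prop) (hA.measurable_row_mul v i)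
    rw [← h1, hA.map_row_mul v i, ← ofReal_integral_eq_lintegral_ofReal]
    · congr 1
      have h2 := variance_fun_id_gaussianReal (μ := 0) (v := ∑ j, ‖v j‖₊ ^ 2)
      rw [variance_of_integral_eq_zero aemeasurable_id' (by simp)] at h2
      rw [h2, sum_nnnorm_sq_eq]
    · exact (memLp_id_gaussianReal' 2 (by simp)).integrable_sq
    · exact ae_of_all _ fun x => sq_nonneg x
  have h3 : ∀ ω, ENNReal.ofReal (∑ i, (∑ j, A ω i j * v j) ^ 2)
      = ∑ i, ENNReal.ofReal ((∑ j, A ω i j * v j) ^ 2) := fun ω =>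
    ENNReal.ofReal_sum_of_nonneg fun i _ => sq_nonneg _
  simp_rw [h3]
  rw [lintegral_finsetSum]
  · simp [hrow, ENNReal.ofReal_mul]
  · intro i _
    exact ((hA.measurable_row_mul v i).pow_const 2).ennreal_ofReal

lemma measure_norm_mulVec_sq_ge (hA : IsStdGaussianMatrix μ A) (v : Fin n → ℝ) {t : ℝ}
    (ht : 0 < t) :
    μ {ω | t ≤ ‖WithLp.toLp 2 ((A ω).mulVec v)‖ ^ 2}
      ≤ ENNReal.ofReal (m * ‖WithLp.toLp 2 v‖ ^ 2 / t) := by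
  have hm : AEMeasurable (fun ω => ENNReal.ofReal (‖WithLp.toLp 2 ((A ω).mulVec v)‖ ^ 2)) μ := by
    simp_rw [norm_mulVec_sq]
    exact (Finset.measurable_sum _ fun i _ =>
      (hA.measurable_row_mul v i).pow_const 2).ennreal_ofReal.aemeasurable
  have h := meas_ge_le_lintegral_div hm (ENNReal.ofReal_pos.2 ht).ne' ENNReal.ofReal_ne_top
  rw [hA.lintegral_norm_mulVec_sq, ← ENNReal.ofReal_div_of_pos ht] at h
  refine (measure_mono fun ω hω => ?_).trans h
  exact ENNReal.ofReal_le_ofReal hω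

/-- Chernoff's bound for the lower tail of a chi-squared variable. -/
lemma measure_norm_mulVec_sq_le (hA : IsStdGaussianMatrix μ A) {v : Fin n → ℝ} (hm : 0 < m)
    {V t : ℝ} (hV : 0 < V) (hv : V ≤ ‖WithLp.toLp 2 v‖ ^ 2) (ht : 0 < t) :
    μ {ω | ‖WithLp.toLp 2 ((A ω).mulVec v)‖ ^ 2 ≤ t}
      ≤ ENNReal.ofReal (√(Real.exp 1 * (t / (m * V))) ^ m) := by
  have hm' : (0 : ℝ) < m := by exact_mod_cast hm
  -- This is the optimal Chernoff parameter up to the bounded term $1/(2W)$. It makes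
  -- $e^{st}=e^{m/2}$ and $1+2sW\ge mW/t$.
  set s : ℝ := m / (2 * t) with hs
  have hs0 : 0 < s := by positivity
  set W : NNReal := ∑ j, ‖v j‖₊ ^ 2 with hW
  have hWV : V ≤ W := by rw [hW, sum_nnnorm_sq_eq]; exact hv
  have hW0 : W ≠ 0 := by
    rintro h
    rw [h] at hWV
    exact absurd hV (not_lt.2 hWV)
  set R : Fin m → Ω → ℝ := fun i ω => (∑ j, A ω i j * v j) ^ 2 with hR
  have hRm : ∀ i, Measurable (R i) := fun i => (hA.measurable_row_mul v i).pow_const 2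
  have hmgf : ∀ i, mgf (R i) μ (-s) = (√(1 + 2 * s * W))⁻¹ := by
    intro i
    rw [← integral_exp_neg_sq_gaussian hs0 hW0, ← hA.map_row_mul v i, integral_map
      (hA.measurable_row_mul v i).aemeasurable (by fun_prop)]
    rfl
  have hsum : mgf (∑ i, R i) μ (-s) = (√(1 + 2 * s * W))⁻¹ ^ m := by
    have hi : iIndepFun R μ := hA.iIndepFun_row_mul_sq v
    rw [hi.mgf_sum hRm, Finset.prod_congr rfl fun i _ => hmgf i]
    simp
  have hRs : ∀ ω, ‖WithLp.toLp 2 ((A ω).mulVec v)‖ ^ 2 = (∑ i, R i) ω := by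
    intro ω
    rw [norm_mulVec_sq, Finset.sum_apply]
  have hint : Integrable (fun ω => Real.exp (-s * (∑ i, R i) ω)) μ := by
    have hmeas : Measurable fun ω => (∑ i, R i) ω := by
      simp only [Finset.sum_apply]
      exact Finset.measurable_sum _ fun i _ => hRm i
    refine Integrable.of_bound (by fun_prop) 1 (ae_of_all _ fun ω => ?_)
    rw [Real.norm_of_nonneg (Real.exp_pos _).le, Real.exp_le_one_iff, ← hRs]
    have := mul_nonneg hs0.le (sq_nonneg ‖WithLp.toLp 2 ((A ω).mulVec v)‖)
    linarith
  have h := measure_le_le_exp_mul_mgf t (neg_nonpos.2 hs0.le) hint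
  rw [hsum, neg_neg] at h
  simp_rw [hRs]
  rw [← ofReal_measureReal]
  refine ENNReal.ofReal_le_ofReal (h.trans ?_)
  have h1 : Real.exp (s * t) = √(Real.exp 1) ^ m := by
    rw [Real.sqrt_eq_rpow, ← Real.exp_mul, ← Real.exp_nat_mul]
    congr 1
    rw [hs]
    field_simp
  rw [h1, Real.sqrt_mul (Real.exp_pos 1).le, mul_pow]
  refine mul_le_mul_of_nonneg_left (pow_le_pow_left₀ (by positivity) ?_ m) (by positivity)
  rw [← Real.sqrt_inv]
  refine Real.sqrt_le_sqrt ?_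
  have h2 : t / (m * V) = (m * V / t)⁻¹ := by rw [inv_div]
  rw [h2]
  refine inv_anti₀ (by positivity) ?_
  have h3 : 2 * s * W = m * W / t := by rw [hs]; field_simp
  rw [h3]
  have h4 : m * V / t ≤ m * W / t := by gcongr
  linarith

/-- Fubini's theorem for a random matrix that is independent of a random vector. -/
lemma measure_prod_le (hA : IsStdGaussianMatrix μ A) {x : Ω → Fin n → ℝ} (hx : Measurable x)
    (hAx : IndepFun (fun ω (p : Fin m × Fin n) => A ω p.1 p.2) x μ)
    {P : Matrix (Fin m) (Fin n) ℝ → (Fin n → ℝ) → Prop}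
    (hP : MeasurableSet {q : (Fin m × Fin n → ℝ) × (Fin n → ℝ) |
      P (Matrix.of fun i j => q.1 (i, j)) q.2})
    {c : ENNReal} (hc : ∀ y, μ {ω | P (A ω) y} ≤ c) :
    μ {ω | P (A ω) (x ω)} ≤ c := by
  have hAm : Measurable fun ω (p : Fin m × Fin n) => A ω p.1 p.2 :=
    measurable_pi_lambda _ fun p => hA.meas p.1 p.2
  have h := (indepFun_iff_map_prod_eq_prod_map_map hAm.aemeasurable hx.aemeasurable).1 hAx
  have h1 : μ {ω | P (A ω) (x ω)} = (μ.map fun ω => ((fun p : Fin m × Fin n => A ω p.1 p.2), x ω))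
      {q | P (Matrix.of fun i j => q.1 (i, j)) q.2} := by
    rw [Measure.map_apply (hAm.prodMk hx) hP]
    rfl
  have : IsProbabilityMeasure (μ.map x) := Measure.isProbabilityMeasure_map hx.aemeasurable
  have : IsProbabilityMeasure (μ.map fun ω (p : Fin m × Fin n) => A ω p.1 p.2) :=
    Measure.isProbabilityMeasure_map hAm.aemeasurable
  rw [h1, h, Measure.prod_apply_symm hP]
  refine (lintegral_mono (g := fun _ => c) fun y => ?_).trans (by simp)
  rw [Measure.map_apply hAm (measurable_prodMk_right hP)]
  exact hc y

end IsStdGaussianMatrix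

end CS

/-! ### Quantization error, the union bound and optimality. -/

namespace CS

lemma measurable_quant (b : ℕ) : Measurable (quant b) := by
  unfold quant
  fun_prop

lemma sub_quant_sq_le (b : ℕ) (x : ℝ) : (x - quant b x) ^ 2 ≤ ((4 : ℝ) ^ b)⁻¹ := by
  have h2 : (0 : ℝ) < 2 ^ b := by positivity
  have h : x - quant b x = Int.fract ((2 : ℝ) ^ b * x) / 2 ^ b := by
    rw [quant, ← Int.self_sub_floor]
    field_simp
  have h4 : (4 : ℝ) ^ b = (2 ^ b) ^ 2 := by rw [← pow_mul, mul_comm, pow_mul]; norm_num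
  rw [h, div_pow, h4, div_eq_mul_inv]
  exact mul_le_of_le_one_left (by positivity)
    (pow_le_one₀ (Int.fract_nonneg _) (Int.fract_lt_one _).le)

lemma norm_sub_quantVec_sq_le {n : ℕ} (b : ℕ) (x : Fin n → ℝ) :
    ‖WithLp.toLp 2 (x - quantVec b x)‖ ^ 2 ≤ n * ((4 : ℝ) ^ b)⁻¹ := by
  rw [EuclideanSpace.norm_sq_eq]
  refine (Finset.sum_le_card_nsmul _ _ (((4 : ℝ) ^ b)⁻¹) fun i _ => ?_).trans_eq (by simp)
  rw [Real.norm_eq_abs, sq_abs]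
  exact sub_quant_sq_le b (x i)

namespace IsStdGaussianMatrix

variable {Ω : Type*} [MeasurableSpace Ω] {m n : ℕ} {μ : Measure Ω} [IsProbabilityMeasure μ]
  {A : Ω → Matrix (Fin m) (Fin n) ℝ} {x : Ω → Fin n → ℝ}

lemma measure_norm_mulVec_sub_quantVec_ge (hA : IsStdGaussianMatrix μ A) (hx : Measurable x)
    (hAx : IndepFun (fun ω (p : Fin m × Fin n) => A ω p.1 p.2) x μ) (b : ℕ) {t : ℝ} (ht : 0 < t) :
    μ {ω | t ≤ ‖WithLp.toLp 2 ((A ω).mulVec (x ω - quantVec b (x ω)))‖ ^ 2}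
      ≤ ENNReal.ofReal (m * (n * ((4 : ℝ) ^ b)⁻¹) / t) := by
  refine hA.measure_prod_le (P := fun a y =>
    t ≤ ‖WithLp.toLp 2 (a.mulVec (y - quantVec b y))‖ ^ 2) hx hAx ?_ fun y => ?_
  · simp only [norm_mulVec_sq, Matrix.of_apply, Pi.sub_apply, quantVec]
    have hq := measurable_quant b
    refine measurableSet_le measurable_const ?_
    fun_prop
  · refine (hA.measure_norm_mulVec_sq_ge _ ht).trans (ENNReal.ofReal_le_ofReal ?_)
    have := norm_sub_quantVec_sq_le b y
    gcongr

lemma measure_exists_norm_mulVec_sub_le (hA : IsStdGaussianMatrix μ A) (hx : Measurable x)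
    (hAx : IndepFun (fun ω (p : Fin m × Fin n) => A ω p.1 p.2) x μ) (hm : 0 < m)
    (U : Finset (Fin n → ℝ)) {V t : ℝ} (hV : 0 < V) (ht : 0 < t) :
    μ {ω | ∃ u ∈ U, V ≤ ‖WithLp.toLp 2 (x ω - u)‖ ^ 2 ∧
        ‖WithLp.toLp 2 ((A ω).mulVec (x ω - u))‖ ^ 2 ≤ t}
      ≤ ENNReal.ofReal (U.card * √(Real.exp 1 * (t / (m * V))) ^ m) := by
  have hU : {ω | ∃ u ∈ U, V ≤ ‖WithLp.toLp 2 (x ω - u)‖ ^ 2 ∧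
        ‖WithLp.toLp 2 ((A ω).mulVec (x ω - u))‖ ^ 2 ≤ t}
      = ⋃ u ∈ U, {ω | V ≤ ‖WithLp.toLp 2 (x ω - u)‖ ^ 2 ∧
        ‖WithLp.toLp 2 ((A ω).mulVec (x ω - u))‖ ^ 2 ≤ t} := by
    ext ω
    simp only [Set.mem_iUnion, Set.mem_ofPred_eq, exists_prop]
  rw [hU]
  refine (measure_biUnion_finset_le U _).trans ?_
  refine (Finset.sum_le_card_nsmul _ _
    (ENNReal.ofReal (√(Real.exp 1 * (t / (m * V))) ^ m)) fun u _ => ?_).trans_eq ?_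
  · refine hA.measure_prod_le (P := fun a y => V ≤ ‖WithLp.toLp 2 (y - u)‖ ^ 2 ∧
      ‖WithLp.toLp 2 (a.mulVec (y - u))‖ ^ 2 ≤ t) hx hAx ?_ fun y => ?_
    · simp only [norm_mulVec_sq]
      simp only [EuclideanSpace.norm_sq_eq, Matrix.of_apply, Pi.sub_apply]
      have h1 : Measurable fun q : (Fin m × Fin n → ℝ) × (Fin n → ℝ) =>
          ∑ j, ‖q.2 j - u j‖ ^ 2 := by fun_prop
      have h2 : Measurable fun q : (Fin m × Fin n → ℝ) × (Fin n → ℝ) =>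
          ∑ i, (∑ j, q.1 (i, j) * (q.2 j - u j)) ^ 2 := by fun_prop
      exact (measurableSet_le measurable_const h1).inter (measurableSet_le h2 measurable_const)
    · by_cases hy : V ≤ ‖WithLp.toLp 2 (y - u)‖ ^ 2
      · simpa only [hy, true_and] using hA.measure_norm_mulVec_sq_le hm hV hy ht
      -- For a fixed source value close to `u` the event is empty, so Chernoff's bound is used only
      -- at distant values.
      · exact (measure_mono_null (t := ∅) (fun ω h => hy h.1) measure_empty).le.trans zero_le
  · rw [nsmul_eq_mul, ENNReal.ofReal_mul (Nat.cast_nonneg _), ENNReal.ofReal_natCast]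

end IsStdGaussianMatrix

/-- An upper bound for the union bound over the sequences of small conditional empirical entropy. -/
lemma card_mul_pow_le {n m b k : ℕ} (hn : 0 < n) (hk : k ≤ n) {d d' ρ s : ℝ} (hs : 0 ≤ s)
    (hsmall : Real.logb 2 (n + 1) * 2 ^ ((b + 1) * (k + 1)) + (b + 1) * k ≤ n)
    (hρ : 0 ≤ ρ) (hsρ : s ≤ 2 ^ (-ρ)) (hm : d' * n ≤ m) (hd : d * b + 2 ≤ d' * ρ) :
    ((((tuples (quantFinset b) n).filter fun u => condEmpEntropy k u ≤ d * b).card : ℕ) : ℝ) * s ^ m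
      ≤ (2 : ℝ) ^ (-(n : ℝ)) := by
  have hS : ((quantFinset b).card : ℝ) ≤ 2 ^ (b + 1) := by exact_mod_cast card_quantFinset_le b
  have hn1 : (0 : ℝ) < (n : ℝ) + 1 := by positivity
  have h1 : ((n : ℝ) + 1) ^ ((quantFinset b).card ^ (k + 1))
      ≤ 2 ^ (Real.logb 2 (n + 1) * 2 ^ ((b + 1) * (k + 1))) := by
    rw [Real.rpow_mul two_pos.le, Real.rpow_logb two_pos one_lt_two.ne' hn1, pow_mul,
      ← Real.rpow_natCast]
    refine Real.rpow_le_rpow_of_exponent_le (by linarith [Nat.cast_nonneg (α := ℝ) n]) ?_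
    push_cast
    exact pow_le_pow_left₀ (by positivity) hS _
  have h2 : ((quantFinset b).card : ℝ) ^ k ≤ 2 ^ (((b : ℝ) + 1) * k) := by
    refine (pow_le_pow_left₀ (by positivity) hS k).trans_eq ?_
    rw [← pow_mul, ← Real.rpow_natCast]
    push_cast
    rfl
  have h3 := card_condEmpEntropy_le hn hk (quantFinset b) (d * b)
  -- Of the surplus $2n$ in the exponent, one $n$ absorbs the number of types and the initial
  -- contexts; the other is the final $2^{-n}$.
  have h4 : s ^ m ≤ 2 ^ (-((d * b + 2) * n)) := by
    refine (pow_le_pow_left₀ hs hsρ m).trans ?_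
    rw [← Real.rpow_mul_natCast two_pos.le]
    refine Real.rpow_le_rpow_of_exponent_le one_le_two ?_
    have h5 := mul_le_mul_of_nonneg_left hm hρ
    have h6 := mul_le_mul_of_nonneg_right hd (Nat.cast_nonneg (α := ℝ) n)
    linarith
  calc _ ≤ ((2 : ℝ) ^ (Real.logb 2 (n + 1) * 2 ^ ((b + 1) * (k + 1))) * 2 ^ (((b : ℝ) + 1) * k)
        * 2 ^ (n * (d * b))) * 2 ^ (-((d * b + 2) * n)) := by
        refine mul_le_mul (h3.trans ?_) h4 (by positivity) (by positivity)
        gcongr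
    _ = (2 : ℝ) ^ (Real.logb 2 (n + 1) * 2 ^ ((b + 1) * (k + 1)) + ((b : ℝ) + 1) * k
        + n * (d * b) + -((d * b + 2) * n)) := by
        rw [Real.rpow_add two_pos, Real.rpow_add two_pos, Real.rpow_add two_pos]
    _ ≤ _ := by
        refine Real.rpow_le_rpow_of_exponent_le one_le_two ?_
        linarith

lemma norm_add_sq_le_two {E : Type*} [SeminormedAddCommGroup E] (v w : E) :
    ‖v + w‖ ^ 2 ≤ 2 * (‖v‖ ^ 2 + ‖w‖ ^ 2) :=
  (pow_le_pow_left₀ (norm_nonneg _) (norm_add_le v w) 2).trans (add_sq_le)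

/-- A solution of the Lagrangian problem has small conditional empirical entropy and nearly the
same measurements as the source block. -/
lemma IsMEPSolution.condEmpEntropy_le_and_norm_le {m n k b : ℕ} (hn : 0 < n) {B : ℝ} (hB : 0 < B)
    {lam : ℝ} (hlam : lam = B ^ 2) {A : Matrix (Fin m) (Fin n) ℝ} {x q u : Fin n → ℝ}
    {z y : Fin m → ℝ} (hy : y = A.mulVec x + z) (hu : IsMEPSolution k b lam A y u)
    (hq : ∀ i, q i ∈ quantAlphabet b) {h₁ h₂ e C : ℝ} (hH : condEmpEntropy k q ≤ h₁)
    (hAq : ‖WithLp.toLp 2 (A.mulVec (x - q))‖ ^ 2 ≤ e * n ^ 2 / B ^ 2)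
    (hz : ‖WithLp.toLp 2 z‖ ≤ C * n / B) (h12 : h₁ + 2 * (e + C ^ 2) ≤ h₂) :
    condEmpEntropy k u ≤ h₂ ∧
      ‖WithLp.toLp 2 (A.mulVec (x - u))‖ ^ 2 ≤ 2 * (h₂ + C ^ 2) * n ^ 2 / B ^ 2 := by
  have hn' : (0 : ℝ) < n := by exact_mod_cast hn
  have hz2 : ‖WithLp.toLp 2 z‖ ^ 2 ≤ C ^ 2 * n ^ 2 / B ^ 2 := by
    refine (pow_le_pow_left₀ (norm_nonneg _) hz 2).trans_eq ?_
    rw [div_pow, mul_pow]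
  have hq2 : ‖WithLp.toLp 2 (A.mulVec q - y)‖ ^ 2 ≤ 2 * (e + C ^ 2) * n ^ 2 / B ^ 2 := by
    have h1 : WithLp.toLp 2 (A.mulVec q - y)
        = -(WithLp.toLp 2 (A.mulVec (x - q)) + WithLp.toLp 2 z) := by
      rw [hy, Matrix.mulVec_sub, ← WithLp.toLp_add, ← WithLp.toLp_neg]
      congr 1
      abel
    rw [h1, norm_neg]
    refine (norm_add_sq_le_two _ _).trans ((mul_le_mul_of_nonneg_left (add_le_add hAq hz2)
      two_pos.le).trans_eq ?_)
    ring
  have hcost := hu.2 q hq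
  unfold mepCost at hcost
  have h3 : lam / (n : ℝ) ^ 2 * ‖WithLp.toLp 2 (A.mulVec q - y)‖ ^ 2 ≤ 2 * (e + C ^ 2) := by
    refine (mul_le_mul_of_nonneg_left hq2 (by rw [hlam]; positivity)).trans_eq ?_
    rw [hlam]
    field_simp
  have h4 : 0 ≤ lam / (n : ℝ) ^ 2 * ‖WithLp.toLp 2 (A.mulVec u - y)‖ ^ 2 := by
    rw [hlam]; positivity
  have h5 := condEmpEntropy_nonneg hn k u
  -- Both cost terms are nonnegative, so the cost of `q`, at most `h₂`, bounds each of them at `u`.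
  refine ⟨by linarith, ?_⟩
  have h6 : ‖WithLp.toLp 2 (A.mulVec u - y)‖ ^ 2 ≤ h₂ * n ^ 2 / B ^ 2 := by
    have h7 : lam / (n : ℝ) ^ 2 * ‖WithLp.toLp 2 (A.mulVec u - y)‖ ^ 2 ≤ h₂ := by linarith
    rw [hlam, div_mul_eq_mul_div, div_le_iff₀ (by positivity)] at h7
    rw [le_div_iff₀ (by positivity)]
    linarith
  have h8 : WithLp.toLp 2 (A.mulVec (x - u))
      = -(WithLp.toLp 2 (A.mulVec u - y) + WithLp.toLp 2 z) := by
    rw [hy, Matrix.mulVec_sub, ← WithLp.toLp_add, ← WithLp.toLp_neg]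
    congr 1
    abel
  rw [h8, norm_neg]
  refine (norm_add_sq_le_two _ _).trans ((mul_le_mul_of_nonneg_left (add_le_add h6 hz2)
    two_pos.le).trans_eq ?_)
  ring

end CS

/-! ### Asymptotics of the parameters. -/

namespace CS

lemma tendsto_logb_natCast : Tendsto (fun n : ℕ => Real.logb 2 n) atTop atTop :=
  (Real.tendsto_logb_atTop one_lt_two).comp tendsto_natCast_atTop_atTop

lemma tendsto_logb_logb_natCast :
    Tendsto (fun n : ℕ => Real.logb 2 (Real.logb 2 n)) atTop atTop :=
  (Real.tendsto_logb_atTop one_lt_two).comp tendsto_logb_natCast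

lemma isLittleO_logb_natCast_sqrt :
    (fun n : ℕ => Real.logb 2 n) =o[atTop] fun n : ℕ => √(n : ℝ) := by
  have h := (isLittleO_log_rpow_atTop (r := 1 / 2) (by norm_num)).comp_tendsto
    (tendsto_natCast_atTop_atTop (R := ℝ))
  simp only [Real.sqrt_eq_rpow]
  exact (h.const_mul_left (Real.log 2)⁻¹).congr_left fun n => by
    simp [Real.logb, div_eq_inv_mul]

section rates

variable {r : ℝ} {b k : ℕ → ℕ}

lemma tendsto_ceil_mul_logb_logb (hr : 0 < r)
    (hb : ∀ n : ℕ, b n = ⌈r * Real.logb 2 (Real.logb 2 n)⌉₊) : Tendsto b atTop atTop := by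
  have h : b = fun n : ℕ => ⌈r * Real.logb 2 (Real.logb 2 n)⌉₊ := funext hb
  rw [h]
  exact tendsto_nat_ceil_atTop.comp (tendsto_logb_logb_natCast.const_mul_atTop hr)

lemma eventually_rpow_le_two_pow (hr : 0 < r)
    (hb : ∀ n : ℕ, b n = ⌈r * Real.logb 2 (Real.logb 2 n)⌉₊) :
    ∀ᶠ n : ℕ in atTop, 0 < Real.logb 2 n ∧ Real.logb 2 n ^ r ≤ 2 ^ b n ∧
      (2 : ℝ) ^ b n ≤ 2 * Real.logb 2 n ^ r := by
  filter_upwards [tendsto_logb_natCast.eventually_gt_atTop 0,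
    tendsto_logb_logb_natCast.eventually_gt_atTop 0] with n h1 h2
  have h3 : Real.logb 2 n ^ r = 2 ^ (r * Real.logb 2 (Real.logb 2 n)) := by
    rw [mul_comm, Real.rpow_mul two_pos.le, Real.rpow_logb two_pos one_lt_two.ne' h1]
  have h4 := Nat.le_ceil (r * Real.logb 2 (Real.logb 2 n))
  have h5 := Nat.ceil_lt_add_one (mul_pos hr h2).le
  rw [← hb] at h4 h5
  refine ⟨h1, ?_, ?_⟩
  · rw [h3, ← Real.rpow_natCast]
    exact Real.rpow_le_rpow_of_exponent_le one_le_two h4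
  · have h6 : (2 : ℝ) * 2 ^ (r * Real.logb 2 (Real.logb 2 n))
        = 2 ^ (r * Real.logb 2 (Real.logb 2 n) + 1) := by
      rw [Real.rpow_add two_pos, Real.rpow_one, mul_comm]
    rw [h3, h6, ← Real.rpow_natCast]
    exact Real.rpow_le_rpow_of_exponent_le one_le_two h5.le

lemma eventually_succ_mul_succ_le (hr : 0 < r)
    (hb : ∀ n : ℕ, b n = ⌈r * Real.logb 2 (Real.logb 2 n)⌉₊)
    (hk : (fun n : ℕ => (k n : ℝ)) =o[atTop]
      (fun n : ℕ => Real.logb 2 n / Real.logb 2 (Real.logb 2 n)))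
    (hk_top : Tendsto k atTop atTop) :
    ∀ᶠ n : ℕ in atTop, ((b n : ℝ) + 1) * (k n + 1) ≤ 1 / 2 * Real.logb 2 n := by
  -- Eventually $b+1\le(r+2)\log\log n$ and $k+1\le 2k$, so this constant yields exactly
  -- $\frac12\log n$; the exponent of the type count is then at most $\sqrt n$.
  have hc : 0 < 1 / (4 * (r + 2)) := by positivity
  filter_upwards [hk.bound hc, hk_top.eventually_ge_atTop 1,
    tendsto_logb_natCast.eventually_gt_atTop 0,
    tendsto_logb_logb_natCast.eventually_ge_atTop 1] with n h1 h2 h3 h4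
  have hl : 0 < Real.logb 2 (Real.logb 2 n) := by linarith
  have h2' : (1 : ℝ) ≤ k n := by exact_mod_cast h2
  have h5 := Nat.ceil_lt_add_one (mul_pos hr hl).le
  rw [← hb] at h5
  rw [Real.norm_of_nonneg (Nat.cast_nonneg _), Real.norm_of_nonneg (div_pos h3 hl).le] at h1
  have h6 : (b n : ℝ) + 1 ≤ (r + 2) * Real.logb 2 (Real.logb 2 n) := by linarith
  have h7 : (k n : ℝ) + 1
      ≤ 2 * (1 / (4 * (r + 2)) * (Real.logb 2 n / Real.logb 2 (Real.logb 2 n))) := by linarith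
  refine (mul_le_mul h6 h7 (by positivity) (by positivity)).trans_eq ?_
  field_simp
  norm_num

lemma eventually_type_count_le (hr : 0 < r)
    (hb : ∀ n : ℕ, b n = ⌈r * Real.logb 2 (Real.logb 2 n)⌉₊)
    (hk : (fun n : ℕ => (k n : ℝ)) =o[atTop]
      (fun n : ℕ => Real.logb 2 n / Real.logb 2 (Real.logb 2 n)))
    (hk_top : Tendsto k atTop atTop) :
    ∀ᶠ n : ℕ in atTop, k n ≤ n ∧
      Real.logb 2 (n + 1) * 2 ^ ((b n + 1) * (k n + 1)) + (b n + 1) * k n ≤ n := by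
  filter_upwards [eventually_succ_mul_succ_le hr hb hk hk_top, eventually_ge_atTop 1,
    tendsto_logb_natCast.eventually_ge_atTop 1,
    isLittleO_logb_natCast_sqrt.bound (by norm_num : (0 : ℝ) < 1 / 4)] with n h1 hn hL hs
  have hn1 : (1 : ℝ) ≤ n := by exact_mod_cast hn
  have hn0 : (0 : ℝ) < n := by linarith
  set L := Real.logb 2 n with hLdef
  rw [Real.norm_of_nonneg (by linarith), Real.norm_of_nonneg (Real.sqrt_nonneg _)] at hs
  have hsq : √(n : ℝ) * √n = n := Real.mul_self_sqrt hn0.le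
  have hs1 : 1 ≤ √(n : ℝ) := Real.one_le_sqrt.2 hn1
  have hsn : √(n : ℝ) ≤ n := by nlinarith
  have h2 : (2 : ℝ) ^ ((b n + 1) * (k n + 1)) ≤ √n := by
    have h3 : √(n : ℝ) = 2 ^ (1 / 2 * L) := by
      rw [mul_comm, Real.rpow_mul two_pos.le, Real.rpow_logb two_pos one_lt_two.ne' hn0,
        Real.sqrt_eq_rpow]
    rw [h3, ← Real.rpow_natCast]
    refine Real.rpow_le_rpow_of_exponent_le one_le_two ?_
    push_cast
    exact h1
  have h4 : Real.logb 2 (n + 1) ≤ 2 * L := by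
    have h5 : Real.logb 2 ((n : ℝ) + 1) ≤ Real.logb 2 (2 * n) :=
      Real.logb_le_logb_of_le one_lt_two (by linarith) (by linarith)
    rw [Real.logb_mul two_ne_zero hn0.ne', Real.logb_self_eq_one one_lt_two] at h5
    linarith
  have hbk : ((b n : ℝ) + 1) * k n ≤ 1 / 2 * L :=
    le_trans (mul_le_mul_of_nonneg_left (by linarith) (by positivity)) h1
  have hkn : (k n : ℝ) ≤ n := by
    have h6 : (1 : ℝ) * k n ≤ ((b n : ℝ) + 1) * k n :=
      mul_le_mul_of_nonneg_right (by linarith [Nat.cast_nonneg (α := ℝ) (b n)])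
        (Nat.cast_nonneg _)
    linarith
  refine ⟨by exact_mod_cast hkn, ?_⟩
  have h7 : Real.logb 2 (n + 1) * 2 ^ ((b n + 1) * (k n + 1)) ≤ 1 / 2 * √n * √n :=
    mul_le_mul (by linarith) h2 (by positivity) (by positivity)
  nlinarith

end rates

/-- Lowering the exponent from $1$ to $\theta$ absorbs the factor $Db$. -/
lemma eventually_mul_le_two_rpow (D : ℝ) {θ : ℝ} (hθ : θ < 1) :
    ∀ᶠ b : ℕ in atTop, √(D * b * ((4 : ℝ) ^ b)⁻¹) ≤ 2 ^ (-(θ * b)) := by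
  have h1 : 1 < (4 : ℝ) ^ (1 - θ) := Real.one_lt_rpow (by norm_num) (by linarith)
  have h2 := (tendsto_pow_const_div_const_pow_of_one_lt 1 h1).const_mul D
  rw [mul_zero] at h2
  filter_upwards [h2.eventually_le_const one_pos] with b hb
  rw [← mul_div_assoc, div_le_one (by positivity), pow_one] at hb
  refine Real.sqrt_le_iff.2 ⟨by positivity, ?_⟩
  have h4 : ((2 : ℝ) ^ (-(θ * b))) ^ 2 = ((4 : ℝ) ^ (1 - θ)) ^ b * ((4 : ℝ) ^ b)⁻¹ := by
    have h5 : (4 : ℝ) = 2 ^ (2 : ℝ) := by norm_num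
    rw [h5, ← Real.rpow_mul two_pos.le, ← Real.rpow_mul_natCast two_pos.le,
      ← Real.rpow_mul_natCast two_pos.le, ← Real.rpow_mul_natCast two_pos.le,
      ← Real.rpow_neg two_pos.le, ← Real.rpow_add two_pos]
    congr 1
    push_cast
    ring
  rw [h4]
  exact mul_le_mul_of_nonneg_right hb (by positivity)

/-- Since $m\ge\kappa n$, eventually $\log m\ge\frac12\log n$; replacing $\log m$ by $\log n$ costs
the factor $2^r$. -/
lemma exists_eventually_noise_le {r : ℝ} (hr : 0 < r) {m : ℕ → ℕ} {c : ℕ → ℝ}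
    (hc : c =O[atTop] (fun l : ℕ => (l : ℝ) / Real.logb 2 l ^ r)) {κ K : ℝ} (hκ : 0 < κ)
    (hm1 : ∀ᶠ n : ℕ in atTop, κ * n ≤ m n) (hm2 : ∀ᶠ n : ℕ in atTop, (m n : ℝ) ≤ K * n)
    (hm_top : Tendsto m atTop atTop) :
    ∃ C : ℝ, ∀ᶠ n : ℕ in atTop, c (m n) ≤ C * n / Real.logb 2 n ^ r := by
  obtain ⟨C, hC0, hC⟩ := hc.exists_pos
  refine ⟨C * (|K| * 2 ^ r), ?_⟩
  filter_upwards [hm_top.eventually hC.bound, hm1, hm2, eventually_gt_atTop 0,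
    tendsto_logb_natCast.eventually_gt_atTop 0,
    tendsto_logb_natCast.eventually_ge_atTop (-2 * Real.logb 2 κ)] with n h1 h2 h3 hn hL hL2
  have hn' : (0 : ℝ) < n := by exact_mod_cast hn
  have h4 : Real.logb 2 n / 2 ≤ Real.logb 2 (m n) := by
    have h5 := Real.logb_le_logb_of_le one_lt_two (by positivity) h2
    rw [Real.logb_mul hκ.ne' hn'.ne'] at h5
    linarith
  have h6 : Real.logb 2 n ^ r / 2 ^ r ≤ Real.logb 2 (m n) ^ r := by
    rw [← Real.div_rpow hL.le two_pos.le]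
    exact Real.rpow_le_rpow (by positivity) h4 hr.le
  have hLm : 0 < Real.logb 2 (m n) := by linarith
  rw [Real.norm_of_nonneg (by positivity : 0 ≤ (m n : ℝ) / Real.logb 2 (m n) ^ r)] at h1
  refine (le_abs_self _).trans (h1.trans ?_)
  have h7 : (m n : ℝ) ≤ |K| * n :=
    h3.trans (mul_le_mul_of_nonneg_right (le_abs_self K) hn'.le)
  have h8 : (m n : ℝ) / Real.logb 2 (m n) ^ r ≤ |K| * n / (Real.logb 2 n ^ r / 2 ^ r) :=
    div_le_div₀ (by positivity) h7 (by positivity) h6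
  refine (mul_le_mul_of_nonneg_left h8 hC0.le).trans_eq ?_
  field_simp

end CS

/-! ### Choice of constants and conclusion. -/

namespace CS

lemma exists_linear_bounds {m : ℕ → ℕ}
    (hm : (fun n : ℕ => (m n : ℝ)) =Θ[atTop] (fun n : ℕ => (n : ℝ))) :
    ∃ κ K : ℝ, 0 < κ ∧ 0 < K ∧ (∀ᶠ n : ℕ in atTop, κ * n ≤ m n) ∧
      ∀ᶠ n : ℕ in atTop, (m n : ℝ) ≤ K * n := by
  obtain ⟨K, hK, h1⟩ := hm.1.exists_pos
  obtain ⟨c, hc, h2⟩ := hm.2.exists_pos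
  refine ⟨c⁻¹, K, by positivity, hK, ?_, ?_⟩
  · filter_upwards [h2.bound] with n hn
    simp only [Real.norm_natCast] at hn
    rwa [inv_mul_le_iff₀ hc]
  · filter_upwards [h1.bound] with n hn
    simpa only [Real.norm_natCast] using hn

/-- When the dimension is zero the factor $1+\delta$ gives nothing, and the linear lower bound on
`m` supplies the strict gap. -/
lemma exists_gt_eventually_mul_le {m : ℕ → ℕ} {d δ κ : ℝ} (hd : 0 ≤ d) (hδ : 0 < δ) (hκ : 0 < κ)
    (h1 : ∀ᶠ n : ℕ in atTop, (1 + δ) * d * n ≤ m n) (h2 : ∀ᶠ n : ℕ in atTop, κ * n ≤ m n) :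
    ∃ d' > d, ∀ᶠ n : ℕ in atTop, d' * n ≤ m n := by
  rcases hd.eq_or_lt with rfl | hd
  · exact ⟨κ, hκ, h2⟩
  · exact ⟨(1 + δ) * d, by nlinarith, h1⟩

/-- The Markov slack $\sqrt b$ tends to infinity yet is $o(b)$, so it fits in the gap between `d`
and `d'`. -/
lemma eventually_add_sqrt_le {d d' : ℝ} (h : d < d') {K C : ℝ} :
    ∀ᶠ b : ℕ in atTop, d * b + 2 * (K * √(b : ℝ) + C ^ 2) ≤ d' * b := by
  have hs : Tendsto (fun b : ℕ => √(b : ℝ)) atTop atTop :=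
    Real.tendsto_sqrt_atTop.comp tendsto_natCast_atTop_atTop
  filter_upwards [hs.eventually_ge_atTop 1,
    hs.eventually_ge_atTop ((2 * K + 2 * C ^ 2) / (d' - d))] with b h1 h2
  rw [div_le_iff₀ (sub_pos.2 h)] at h2
  have h3 : √(b : ℝ) * √b = b := Real.mul_self_sqrt (Nat.cast_nonneg b)
  have h4 := mul_le_mul_of_nonneg_left h2 (Real.sqrt_nonneg (b : ℝ))
  have h5 : C ^ 2 * 1 ≤ C ^ 2 * √(b : ℝ) := mul_le_mul_of_nonneg_left h1 (sq_nonneg C)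
  have h6 : √(b : ℝ) * (√b * (d' - d)) = b * (d' - d) := by rw [← mul_assoc, h3]
  linarith

lemma measurable_block {Ω : Type*} [MeasurableSpace Ω] {X : ℤ → Ω → ℝ}
    (hX : ∀ i, Measurable (X i)) (n : ℕ) : Measurable (block X n) :=
  measurable_pi_lambda _ fun _ => hX _

lemma sq_mul_le_norm_sq {n : ℕ} (hn : 0 < n) {ε : ℝ} (hε : 0 < ε) {v : Fin n → ℝ}
    (h : ε ≤ ‖1 / √(n : ℝ) * ‖WithLp.toLp 2 v‖ - 0‖) : ε ^ 2 * n ≤ ‖WithLp.toLp 2 v‖ ^ 2 := by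
  have hn' : (0 : ℝ) < n := by exact_mod_cast hn
  rw [sub_zero, Real.norm_of_nonneg (by positivity), one_div_mul_eq_div,
    le_div_iff₀ (Real.sqrt_pos.2 hn')] at h
  have h2 := pow_le_pow_left₀ (by positivity) h 2
  rwa [mul_pow, Real.sq_sqrt hn'.le] at h2

lemma sqrt_ratio_le {m n b : ℕ} (hn : 0 < n) (hb : 1 ≤ b) {B d C κ ε : ℝ} (hB : 0 < B)
    (hbB : (2 : ℝ) ^ b ≤ 2 * B) (hd : 0 ≤ d) (hκ : 0 < κ) (hε : 0 < ε) (hm : κ * n ≤ m) :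
    √(Real.exp 1 * (2 * (d * b + C ^ 2) * n ^ 2 / B ^ 2 / (m * (ε ^ 2 * n))))
      ≤ √(8 * Real.exp 1 * (d + C ^ 2) / (κ * ε ^ 2) * b * ((4 : ℝ) ^ b)⁻¹) := by
  have hn' : (0 : ℝ) < n := by exact_mod_cast hn
  have hb' : (1 : ℝ) ≤ b := by exact_mod_cast hb
  have hB4 : (B ^ 2)⁻¹ ≤ 4 * ((4 : ℝ) ^ b)⁻¹ := by
    have h1 := pow_le_pow_left₀ (by positivity) hbB 2
    rw [← pow_mul, mul_comm b 2, pow_mul, mul_pow] at h1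
    norm_num at h1
    rw [inv_le_comm₀ (by positivity) (by positivity), mul_inv, inv_inv]
    linarith
  refine Real.sqrt_le_sqrt ?_
  have h2 : 2 * (d * b + C ^ 2) ≤ 2 * (d + C ^ 2) * b := by
    have := mul_le_mul_of_nonneg_left hb' (sq_nonneg C)
    linarith
  have h3 : κ * n * (ε ^ 2 * n) ≤ m * (ε ^ 2 * n) := by gcongr
  calc Real.exp 1 * (2 * (d * b + C ^ 2) * n ^ 2 / B ^ 2 / (m * (ε ^ 2 * n)))
      ≤ Real.exp 1 * (2 * (d + C ^ 2) * b * n ^ 2 / B ^ 2 / (κ * n * (ε ^ 2 * n))) := by gcongr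
    _ = 2 * Real.exp 1 * (d + C ^ 2) / (κ * ε ^ 2) * b * (B ^ 2)⁻¹ := by field_simp
    _ ≤ 2 * Real.exp 1 * (d + C ^ 2) / (κ * ε ^ 2) * b * (4 * ((4 : ℝ) ^ b)⁻¹) := by gcongr
    _ = _ := by ring

lemma chebyshev_ratio_le {m n b : ℕ} (hn : 0 < n) (hb : 1 ≤ b) {B K : ℝ} (hB : 0 < B)
    (hK : 0 < K) (hBb : B ≤ 2 ^ b) (hm : (m : ℝ) ≤ K * n) :
    m * (n * ((4 : ℝ) ^ b)⁻¹) / (K * √(b : ℝ) * n ^ 2 / B ^ 2) ≤ 1 / √(b : ℝ) := by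
  have hn' : (0 : ℝ) < n := by exact_mod_cast hn
  have hsb : 0 < √(b : ℝ) := Real.sqrt_pos.2 (by exact_mod_cast hb)
  have h1 : B ^ 2 ≤ 4 ^ b := by
    refine (pow_le_pow_left₀ hB.le hBb 2).trans_eq ?_
    rw [← pow_mul, mul_comm b 2, pow_mul]
    norm_num
  calc m * (n * ((4 : ℝ) ^ b)⁻¹) / (K * √(b : ℝ) * n ^ 2 / B ^ 2)
      ≤ K * n * (n * (B ^ 2)⁻¹) / (K * √(b : ℝ) * n ^ 2 / B ^ 2) := by gcongr
    _ = _ := by field_simp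

end CS

theorem theorem9 {Ω : Type*} [MeasurableSpace Ω] (μ : Measure Ω) [IsProbabilityMeasure μ]
    (X : ℤ → Ω → ℝ) (hXmeas : ∀ i, Measurable (X i)) (hX01 : ∀ i ω, X i ω ∈ Set.Icc (0 : ℝ) 1)
    (hXstat : CS.IsStationary μ X) (hXmix : CS.IsPsiStarMixing μ X)
    (r δ : ℝ) (hr : 1 < r) (hδ : 0 < δ)
    (b k m : ℕ → ℕ) (lam : ℕ → ℝ)
    (hb : ∀ n : ℕ, b n = ⌈r * Real.logb 2 (Real.logb 2 n)⌉₊)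
    (hk : (fun n : ℕ => (k n : ℝ)) =o[atTop]
      (fun n : ℕ => Real.logb 2 n / Real.logb 2 (Real.logb 2 n)))
    (hk_top : Tendsto k atTop atTop)
    (hlam : ∀ n : ℕ, lam n = Real.logb 2 n ^ (2 * r))
    (hm : ∀ᶠ n : ℕ in atTop, (1 + δ) * CS.upperInfoDim μ X * n ≤ m n)
    (hm_lin : (fun n : ℕ => (m n : ℝ)) =Θ[atTop] (fun n : ℕ => (n : ℝ)))
    (A : (n : ℕ) → Ω → Matrix (Fin (m n)) (Fin n) ℝ)
    (hA_meas : ∀ n i j, Measurable (fun ω => A n ω i j))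
    (hA_law : ∀ n i j, μ.map (fun ω => A n ω i j) = gaussianReal 0 1)
    (hA_indep : ∀ n, iIndepFun (fun (p : Fin (m n) × Fin n) ω => A n ω p.1 p.2) μ)
    (hAX : ∀ n, IndepFun (fun ω (p : Fin (m n) × Fin n) => A n ω p.1 p.2) (CS.block X n) μ)
    (Z : (n : ℕ) → Ω → Fin (m n) → ℝ) (hZmeas : ∀ n, Measurable (Z n))
    (c : ℕ → ℝ)
    (hc : c =O[atTop] (fun l : ℕ => (l : ℝ) / Real.logb 2 l ^ r))
    (hZ : Tendsto (fun n => μ {ω | c (m n) < ‖WithLp.toLp 2 (Z n ω)‖}) atTop (𝓝 0))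
    (Y : (n : ℕ) → Ω → Fin (m n) → ℝ)
    (hY : ∀ n ω, Y n ω = (A n ω).mulVec (CS.block X n ω) + Z n ω)
    (Xhat : (n : ℕ) → Ω → Fin n → ℝ)
    (hXhat : ∀ n ω, CS.IsMEPSolution (k n) (b n) (lam n) (A n ω) (Y n ω) (Xhat n ω)) :
    TendstoInMeasure μ
      (fun (n : ℕ) ω => 1 / √(n : ℝ) * ‖WithLp.toLp 2 (CS.block X n ω - Xhat n ω)‖)
      atTop (fun _ => 0) := by
  classical
  have hr0 : 0 < r := by linarith
  have hb_top := CS.tendsto_ceil_mul_logb_logb hr0 hb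
  have hG : ∀ n, CS.IsStdGaussianMatrix μ (A n) := fun n => ⟨hA_meas n, hA_law n, hA_indep n⟩
  obtain ⟨κ, K, hκ, hK, hm1, hm2⟩ := CS.exists_linear_bounds hm_lin
  have hm_top : Tendsto m atTop atTop := by
    rw [← tendsto_natCast_atTop_iff (R := ℝ)]
    exact tendsto_atTop_mono' atTop hm1 (tendsto_natCast_atTop_atTop.const_mul_atTop hκ)
  have hdim0 := CS.upperInfoDim_nonneg (μ := μ) hXmeas hX01 hXstat
  obtain ⟨d₃, hd₃, hm3⟩ := CS.exists_gt_eventually_mul_le hdim0 hδ hκ hm hm1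
  obtain ⟨d₂, hd₂, hd₂₃⟩ := exists_between hd₃
  obtain ⟨d₁, hd₁, hd₁₂⟩ := exists_between hd₂
  have hd₂0 : 0 < d₂ := hdim0.trans_lt hd₂
  have hd₃0 : 0 < d₃ := hd₂0.trans hd₂₃
  -- $\theta<1$ is what the Chernoff bound can deliver, and $d_2<\theta d_3$ is what the union bound
  -- needs.
  obtain ⟨θ, hθ1, hθ2⟩ := exists_between ((div_lt_one hd₃0).2 hd₂₃)
  rw [div_lt_iff₀ hd₃0] at hθ1
  have hθ0 : 0 < θ := by
    by_contra h
    have := mul_nonpos_of_nonpos_of_nonneg (not_lt.1 h) hd₃0.le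
    linarith
  obtain ⟨C, hC⟩ := CS.exists_eventually_noise_le hr0 hc hκ hm1 hm2 hm_top
  have hE1 := CS.tendsto_measure_condEmpEntropy_gt (μ := μ) hXmeas hX01 hXstat hXmix hb_top
    hk_top hd₁
  rw [tendstoInMeasure_iff_norm]
  intro ε hε
  have hE2 : Tendsto (fun n => ENNReal.ofReal (1 / √(b n : ℝ))) atTop (𝓝 0) := by
    rw [← ENNReal.ofReal_zero]
    refine ENNReal.tendsto_ofReal (Tendsto.const_div_atTop ?_ 1)
    exact Real.tendsto_sqrt_atTop.comp (tendsto_natCast_atTop_atTop.comp hb_top)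
  have hE4 : Tendsto (fun n : ℕ => ENNReal.ofReal ((2 : ℝ) ^ (-(n : ℝ)))) atTop (𝓝 0) := by
    rw [← ENNReal.ofReal_zero]
    refine ENNReal.tendsto_ofReal ?_
    simp only [Real.rpow_neg two_pos.le, Real.rpow_natCast]
    exact tendsto_inv_atTop_zero.comp (tendsto_pow_atTop_atTop_of_one_lt one_lt_two)
  have hlin : ∀ᶠ b : ℕ in atTop, d₂ * b + 2 ≤ d₃ * (θ * b) := by
    have h := (tendsto_natCast_atTop_atTop (R := ℝ)).const_mul_atTop
      (sub_pos.2 hθ1)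
    filter_upwards [h.eventually_ge_atTop 2] with b hb
    linarith
  have hbound : ∀ᶠ n : ℕ in atTop,
      μ {ω | ε ≤ ‖1 / √(n : ℝ) * ‖WithLp.toLp 2 (CS.block X n ω - Xhat n ω)‖ - 0‖}
        ≤ μ {ω | d₁ * b n < CS.condEmpEntropy (k n) (CS.quantVec (b n) (CS.block X n ω))}
          + ENNReal.ofReal (1 / √(b n : ℝ))
          + μ {ω | c (m n) < ‖WithLp.toLp 2 (Z n ω)‖}
          + ENNReal.ofReal ((2 : ℝ) ^ (-(n : ℝ))) := by
    filter_upwards [eventually_gt_atTop 0, hb_top.eventually_ge_atTop 1,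
      hm_top.eventually_gt_atTop 0, hm1, hm2, hm3, hC,
      CS.eventually_rpow_le_two_pow hr0 hb, CS.eventually_type_count_le hr0 hb hk hk_top,
      hb_top.eventually (CS.eventually_add_sqrt_le hd₁₂ (K := K) (C := C)),
      hb_top.eventually hlin,
      hb_top.eventually (CS.eventually_mul_le_two_rpow
        (8 * Real.exp 1 * (d₂ + C ^ 2) / (κ * ε ^ 2)) hθ2)]
      with n hn hbn hmn hκn hKn hdn hCn hBn htn hsq hρ hs
    obtain ⟨hL, hB1, hB2⟩ := hBn
    obtain ⟨hkn, htype⟩ := htn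
    have hn' : (0 : ℝ) < n := by exact_mod_cast hn
    have hbn' : (0 : ℝ) < b n := by exact_mod_cast hbn
    have hsb : 0 < √(b n : ℝ) := Real.sqrt_pos.2 hbn'
    set B : ℝ := Real.logb 2 n ^ r with hBdef
    have hB : 0 < B := Real.rpow_pos_of_pos hL r
    have hlamB : lam n = B ^ 2 := by
      rw [hlam, hBdef, ← Real.rpow_natCast, ← Real.rpow_mul hL.le]
      congr 1
      push_cast
      ring
    have hxm := CS.measurable_block hXmeas n
    set t : ℝ := K * √(b n : ℝ) * n ^ 2 / B ^ 2 with ht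
    set T : ℝ := 2 * (d₂ * b n + C ^ 2) * n ^ 2 / B ^ 2 with hT
    set U := (CS.tuples (CS.quantFinset (b n)) n).filter fun u =>
      CS.condEmpEntropy (k n) u ≤ d₂ * b n with hU
    have h2 := ((hG n).measure_norm_mulVec_sub_quantVec_ge hxm (hAX n) (b n)
      (t := t) (by positivity)).trans
      (ENNReal.ofReal_le_ofReal (CS.chebyshev_ratio_le hn hbn hB hK hB1 hKn))
    have h4 := ((hG n).measure_exists_norm_mulVec_sub_le hxm (hAX n) hmn U
      (V := ε ^ 2 * n) (t := T) (by positivity) (by positivity)).trans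
      (ENNReal.ofReal_le_ofReal (CS.card_mul_pow_le hn hkn (Real.sqrt_nonneg _) htype
        (ρ := θ * b n) (by positivity)
        ((CS.sqrt_ratio_le hn hbn hB hB2 hd₂0.le hκ hε hκn).trans hs) hdn hρ))
    refine le_trans ?_ (add_le_add (add_le_add (add_le_add le_rfl h2) le_rfl) h4)
    -- Only monotonicity and subadditivity are used, so the events may be nonmeasurable; no
    -- measurability of `Xhat` is needed.
    refine le_trans (measure_mono fun ω hω => ?_) ((measure_union_le _ _).trans
      (add_le_add ((measure_union_le _ _).trans (add_le_add (measure_union_le _ _) le_rfl)) le_rfl))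
    by_contra hnot
    simp only [Set.mem_union, Set.mem_ofPred_eq, not_or, not_lt, not_le] at hnot
    obtain ⟨⟨⟨g1, g2⟩, g3⟩, g4⟩ := hnot
    have hopt := (hXhat n ω).condEmpEntropy_le_and_norm_le hn hB hlamB (hY n ω)
      (q := CS.quantVec (b n) (CS.block X n ω))
      (fun i => CS.mem_quantAlphabet_iff.2 (CS.quant_mem_quantFinset (hX01 _ _)))
      (e := K * √(b n : ℝ)) g1 g2.le (g3.trans hCn) hsq
    refine g4 ⟨Xhat n ω, Finset.mem_filter.2 ⟨Fintype.mem_piFinset.2 fun i =>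
      CS.mem_quantAlphabet_iff.1 ((hXhat n ω).1 i), hopt.1⟩,
      CS.sq_mul_le_norm_sq hn hε hω, hopt.2⟩
  refine tendsto_of_tendsto_of_tendsto_of_le_of_le' tendsto_const_nhds ?_
    (Eventually.of_forall fun _ => zero_le) hbound
  simpa using ((hE1.add hE2).add hZ).add hE4
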